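/- **Model.** For $S\subseteq[n]=\{1,\dots,n\}$ and $\rho>0$ let $\bar\Sigma_S$ be the $n\times n$ matrix with diagonal entries $1+\rho$ for $i\in S$ and $1$ for $i\notin S$, off-diagonal entries $\rho$ for $i\ne j$ both in $S$, and $0$ otherwise. Let $U^1,U^2,\dots$ be i.i.d. $\mathcal N(0,\bar\Sigma_S)$ vectors in $\mathbb R^n$. One tests $H_0:S=\emptyset$ against $H_1:S\in\mathcal C_k$, where $\mathcal C_k$ is the class of all $k$-element subsets of $[n]$. An adaptive testing procedure with budget $M$ senses at round $t$ a set $A^t\subseteq[n]$ of coordinates of $U^t$, chosen as a measurable function of what was sensed before and of independent additional randomization, with $\sum_t|A^t|\le M$, and decides from the sensed entries. Write $m=M/n$. Its risk is the probability of rejecting under $S=\emptyset$ plus the maximum over $S\in\mathcal C_k$ of the probability of not rejecting. **Variance thresholding.** Fix $\varepsilon>0$. Let $p=\log\log_2 n$, $N=\min(n,\lfloor 2np/k\rfloor)$, $K=\lfloor(1+\varepsilon)\log_2 N\rfloor$ and $q=\lfloor M/(4N)\rfloor$. Draw $\mathcal S_0\subseteq[n]$ uniformly among the $N$-element subsets.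 In step $r=1,\dots,K$, take for each $i\in\mathcal S_{r-1}$ the squares of $q$ fresh samples of coordinate $i$ (each in a round in which only $i$ is sensed), and let $LR_i$ be the likelihood ratio of these $q$ squares, $(1+\rho)\chi_1^2$ against $\chi_1^2$. Let $\mathcal S_r$ be the set of $i\in\mathcal S_{r-1}$ with $LR_i>\gamma$, where $\gamma$ is the median of this ratio when the $q$ squares are i.i.d. $\chi_1^2$. Stop without rejecting as soon as $\sum_{j=0}^r|\mathcal S_j|>4N$. Otherwise reject $H_0$ if and only if $\mathcal S_K\neq\emptyset$. **Proposition.** There is a numerical constant $C_2>0$ such that for every $\varepsilon>0$ the following holds. Let $\rho=\rho_n>0$, $k=k_n$ and $M=M_n$ depend on $n$ so that, as $n\to\infty$, $\rho\to0$, $k\to\infty$, $m=M/n\to\infty$ and $k\log\log\log n=o(n)$ (in particular $k=o(n)$), and suppose that for all large $n$ $$\rho\sqrt{km}\ \ge\ C_2\,\log\log_2 n .$$ Then variance thresholding is an adaptive testing procedure with budget $M$, and its risk converges to $0$ as $n\to\infty$. -/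

import Mathlib

open MeasureTheory ProbabilityTheory Filter

namespace CorrDetect

noncomputable section

/-! ### The observation model and adaptive sensing -/

/-- The data matrix: row `t` is the random vector `U^t`, column `i` is the `i`-th coordinate. -/
abbrev Data (n : ℕ) : Type := ℕ → EuclideanSpace ℝ (Fin n)

/-- The covariance matrix of the unnormalized model with contaminated set `S`. -/
def covUnnormalized {n : ℕ} (ρ : ℝ) (S : Finset (Fin n)) : Matrix (Fin n) (Fin n) ℝ :=
  Matrix.of fun i j =>
    if i = j then (if i ∈ S then 1 + ρ else 1)
    else (if i ∈ S ∧ j ∈ S then ρ else 0)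

/-- The law of the data: i.i.d. centred normal rows. The null hypothesis is `S = ∅`. -/
def dataLaw {n : ℕ} (ρ : ℝ) (S : Finset (Fin n)) : Measure (Data n) :=
  Measure.infinitePi fun _ : ℕ => multivariateGaussian 0 (covUnnormalized ρ S)

/-- The class of `k`-sets. -/
def kSets (n k : ℕ) : Finset (Finset (Fin n)) := Finset.powersetCard k Finset.univ

/-- A randomized testing procedure: `seedLaw` is the additional randomization, independent of the
data, `query ω u t` is the set of coordinates sensed at round `t`, and `reject ω u` says that the
null hypothesis is rejected. That the procedure is adaptive (uses only what it has sensed) and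
respects a budget is the predicate `Procedure.IsAdaptive`. -/
structure Procedure (n : ℕ) where
  Seed : Type
  seedLaw : PMF Seed
  query : Seed → Data n → ℕ → Finset (Fin n)
  reject : Seed → Data n → Prop

/-- The procedure is an adaptive testing procedure with a budget of `M` coordinate measurements:
the query at round `t` is a measurable function of the seed and of the entries sensed before
round `t`, the decision is a measurable function of the seed and of all the sensed entries, and at
most `M` entries are sensed. -/
structure Procedure.IsAdaptive {n : ℕ} (T : Procedure n) (M : ℕ) : Prop where
  measurable_query : ∀ ω t i, MeasurableSet {u | i ∈ T.query ω u t}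
  query_adapted : ∀ ω t u v,
    (∀ s < t, ∀ i ∈ T.query ω u s, u s i = v s i) → T.query ω u t = T.query ω v t
  measurable_reject : ∀ ω, MeasurableSet {u | T.reject ω u}
  reject_adapted : ∀ ω u v,
    (∀ s, ∀ i ∈ T.query ω u s, u s i = v s i) → (T.reject ω u ↔ T.reject ω v)
  budget : ∀ ω ∈ T.seedLaw.support, ∀ u t, ∑ s ∈ Finset.range t, (T.query ω u s).card ≤ M

/-- Worst-case risk over the class `C`: the probability of rejecting under the null plus the
maximal probability of not rejecting under the alternatives. -/
def Procedure.risk {n : ℕ} (T : Procedure n) (P : Finset (Fin n) → Measure (Data n))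
    (C : Finset (Finset (Fin n))) : ENNReal :=
  (∑' ω, T.seedLaw ω * P ∅ {u | T.reject ω u})
    + ⨆ S ∈ C, ∑' ω, T.seedLaw ω * P S {u | ¬ T.reject ω u}

/-! ### Likelihood ratios for the chi-squared distributions -/

/-- The chi-squared distribution with one degree of freedom. -/
def chiSq : Measure ℝ := (gaussianReal 0 1).map fun x => x ^ 2

/-- Lebesgue density of the chi-squared distribution with one degree of freedom. -/
def chiSqDensity (x : ℝ) : ℝ := gammaPDFReal (1 / 2) (1 / 2) x

/-- Lebesgue density of `1 + ρ` times a chi-squared variable with one degree of freedom. -/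
def scaledChiSqDensity (ρ x : ℝ) : ℝ := (1 + ρ)⁻¹ * chiSqDensity (x / (1 + ρ))

/-- Likelihood ratio of `f₁` against `f₀` for `q` i.i.d. observations. -/
def likelihoodRatio (f₁ f₀ : ℝ → ℝ) {q : ℕ} (z : Fin q → ℝ) : ℝ :=
  (∏ t, f₁ (z t)) / ∏ t, f₀ (z t)

/-- The (lower) median of a distribution on the real line. -/
def median (ν : Measure ℝ) : ℝ := sInf {x | 1 / 2 ≤ ν (Set.Iic x)}

/-- The threshold: the median under the null of the likelihood ratio of `q` observations. -/
def threshold (ρ : ℝ) (q : ℕ) : ℝ :=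
  median ((Measure.pi fun _ : Fin q => chiSq).map
    fun z => likelihoodRatio (scaledChiSqDensity ρ) chiSqDensity z)

/-! ### Sequential thresholding on squared single-coordinate samples -/

/-- The round of the `s`-th sample of coordinate `i` in step `r` (steps are numbered from `0`),
when every coordinate is sampled `q` times per step: different samples use different rounds. -/
def slot {n : ℕ} (q r : ℕ) (i : Fin n) (s : ℕ) : ℕ := (r * n + i) * q + s

/-- The likelihood ratio of coordinate `i` in step `r`, from `q` squared fresh samples. -/
def stepLR {n : ℕ} (ρ : ℝ) (q : ℕ) (u : Data n) (r : ℕ) (i : Fin n) : ℝ :=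
  likelihoodRatio (scaledChiSqDensity ρ) chiSqDensity
    fun s : Fin q => (u (slot q r i s) i) ^ 2

/-- The coordinates of `B` that survive the first `r` steps. -/
def survivors {n : ℕ} (ρ : ℝ) (q : ℕ) (B : Finset (Fin n)) (u : Data n) : ℕ → Finset (Fin n)
  | 0 => B
  | r + 1 => (survivors ρ q B u r).filter fun i => threshold ρ q < stepLR ρ q u r i

/-- The procedure has not been terminated by the budget constraint after `r` steps. (`N` is the
number of coordinates of the subsample, and each coordinate is sampled `q = M / (4 * N)` times
per step, so that the budget of `M` allows for `4 * N` such samplings.) -/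
def WithinBudget {n : ℕ} (ρ : ℝ) (q N : ℕ) (B : Finset (Fin n)) (u : Data n) (r : ℕ) : Prop :=
  ∑ j ∈ Finset.range (r + 1), (survivors ρ q B u j).card ≤ 4 * N

open Classical in
/-- The coordinates that are sensed in step `r` (none after termination). -/
def active {n : ℕ} (ρ : ℝ) (q N : ℕ) (B : Finset (Fin n)) (u : Data n) (r : ℕ) :
    Finset (Fin n) :=
  if WithinBudget ρ q N B u r then survivors ρ q B u r else ∅

/-- The size of the random subsample: `⌊2 n p / k⌋` with `p = log (log₂ n)`, or all `n` coordinates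
when there are not that many. -/
def subsampleSize (n k : ℕ) : ℕ :=
  min n ⌊2 * (n : ℝ) * Real.log (Real.logb 2 n) / k⌋₊

/-- The number of steps of sequential thresholding on `N` coordinates. -/
def numSteps (ε : ℝ) (N : ℕ) : ℕ := ⌊(1 + ε) * Real.logb 2 N⌋₊

theorem subsamples_nonempty (n k : ℕ) : (kSets n (subsampleSize n k)).Nonempty := by
  unfold kSets
  rw [Finset.powersetCard_nonempty]
  simp [subsampleSize]

/-- Variance thresholding with a budget of `M` coordinate measurements: draw a subsample `B`
uniformly without replacement, then run sequential thresholding on the squares of independent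
single-coordinate samples of the coordinates in `B`. -/
def varianceThresholding (n k M : ℕ) (ρ ε : ℝ) : Procedure n where
  Seed := Finset (Fin n)
  seedLaw := PMF.uniformOfFinset (kSets n (subsampleSize n k)) (subsamples_nonempty n k)
  query B u t :=
    let N := subsampleSize n k
    let q := M / (4 * N)
    Finset.univ.filter fun i => ∃ r ∈ Finset.range (numSteps ε N), ∃ s ∈ Finset.range q,
      t = slot q r i s ∧ i ∈ active ρ q N B u r
  reject B u :=
    let N := subsampleSize n k
    let q := M / (4 * N)
    let K := numSteps ε N
    WithinBudget ρ q N B u K ∧ (survivors ρ q B u K).Nonempty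

end

end CorrDetect

/-! Different samples use different rounds, so all samples are independent whatever the correlations
inside a row; only the variances 1 and 1 + ρ matter. The likelihood ratio is almost surely an
increasing function of the sum of the q squares.

A clean coordinate passes each step with probability at most 1/2, since γ is the null median. It
survives K steps with probability at most 2^(-K), so a false alarm has probability at most N 2^(-K)
≤ 2 N^(-ε).

A contaminated set S is missed for one of four reasons, one for each term of the second summand in
`risk_varianceThresholding_le`. The subsample avoids S: at most exp(-kN/n), and kN/n → ∞. The
contaminated coordinates could use more than N of the 4N samplings: at most (K+1)k/n in the manner
of Markov, and k log log log n = o(n) makes this vanish. The clean ones use more than 3N: their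
lifetimes are independent with mean at most 2 and variance at most 6, so Chebyshev gives 6/N.
Otherwise a fixed contaminated coordinate is eliminated in some step: `measureReal_le_threshold_le`
and a union bound give K exp(-ρ²q/128).

With p = log log₂ n, subsampling replaces n by N ≤ 2np/k, so q is at least of order km/p and the
signal condition yields ρ²q ≥ 256p. Since K ≤ (1+ε) log₂ n = (1+ε)e^p, the last term is at most
(1+ε)e^(-p). -/

namespace CorrDetect

noncomputable section

/-! ### Chernoff bounds for sums of squared normal variables -/

open scoped NNReal

/-- The left side is the moment generating function of a squared standard normal. Negative x of any
size are allowed, so both tails are covered. -/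
lemma inv_sqrt_one_sub_le {x : ℝ} (hx : x ≤ 1 / 4) :
    (√(1 - 2 * x))⁻¹ ≤ Real.exp (x + 4 * x ^ 2) := by
  have h1 : 0 < 1 - 2 * x := by linarith
  rw [← Real.sqrt_inv]
  refine Real.sqrt_le_iff.2 ⟨(Real.exp_pos _).le, ?_⟩
  rw [← Real.exp_nat_mul]
  refine le_trans ?_ (Real.add_one_le_exp _)
  rw [inv_le_iff_one_le_mul₀ h1]
  push_cast
  -- (1 + 2x + 8x²)(1 - 2x) = 1 + 4x²(1 - 4x); this is where x ≤ 1/4 enters.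
  nlinarith [mul_nonneg (sq_nonneg x) (by linarith : 0 ≤ 1 - 4 * x)]

lemma gaussianPDFReal_smul_exp_mul_sq {v : ℝ≥0} (hv : v ≠ 0) (l x : ℝ) :
    gaussianPDFReal 0 v x • Real.exp (l * x ^ 2) =
      (√(2 * Real.pi * v))⁻¹ * Real.exp (-((1 - 2 * (l * v)) / (2 * v)) * x ^ 2) := by
  have hv' : (v : ℝ) ≠ 0 := by exact_mod_cast hv
  rw [gaussianPDFReal_def, smul_eq_mul, mul_assoc, ← Real.exp_add]
  congr 2
  field_simp
  ring

lemma integrable_exp_mul_sq_gaussianReal {v : ℝ≥0} (hv : v ≠ 0) {l : ℝ} (hl : l * v ≤ 1 / 4) :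
    Integrable (fun x => Real.exp (l * x ^ 2)) (gaussianReal 0 v) := by
  have hv' : (0 : ℝ) < v := by positivity
  rw [gaussianReal_of_var_ne_zero _ hv,
    integrable_withDensity_iff_integrable_smul' (measurable_gaussianPDF _ _)
      (ae_of_all _ fun x => ENNReal.ofReal_lt_top)]
  simp_rw [toReal_gaussianPDF, gaussianPDFReal_smul_exp_mul_sq hv]
  refine (integrable_exp_neg_mul_sq ?_).const_mul _
  have : 0 < 1 - 2 * (l * v) := by linarith
  positivity

lemma integral_exp_mul_sq_gaussianReal_le {v : ℝ≥0} (hv : v ≠ 0) {l : ℝ} (hl : l * v ≤ 1 / 4) :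
    ∫ x, Real.exp (l * x ^ 2) ∂gaussianReal 0 v ≤ Real.exp (l * v + 4 * (l * v) ^ 2) := by
  have hv' : (0 : ℝ) < v := by positivity
  have h1 : 0 < 1 - 2 * (l * v) := by linarith
  rw [integral_gaussianReal_eq_integral_smul hv]
  simp_rw [gaussianPDFReal_smul_exp_mul_sq hv]
  rw [integral_const_mul, integral_gaussian]
  refine le_of_eq_of_le ?_ (inv_sqrt_one_sub_le hl)
  rw [← Real.sqrt_inv, ← Real.sqrt_inv, ← Real.sqrt_mul (by positivity)]
  congr 1
  field_simp

variable {Ω : Type*} [MeasurableSpace Ω] {P : Measure Ω}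

/-- Chernoff bound for sums of squares of i.i.d. centred normal variables. -/
lemma measureReal_le_mul_sum_sq_le {q : ℕ} {v : ℝ≥0} (hv : v ≠ 0) {X : Fin q → Ω → ℝ}
    (hX : ∀ s, Measurable (X s)) (hind : iIndepFun X P)
    (hlaw : ∀ s, P.map (X s) = gaussianReal 0 v) {l : ℝ} (hl : l * v ≤ 1 / 4) (c : ℝ) :
    P.real {ω | c ≤ l * ∑ s, X s ω ^ 2} ≤ Real.exp (-c + q * (l * v + 4 * (l * v) ^ 2)) := by
  have := hind.isProbabilityMeasure
  have hmeas : Measurable fun x : ℝ => l * x ^ 2 := by fun_prop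
  have hind' : iIndepFun (fun s ω => l * X s ω ^ 2) P := hind.comp (fun _ x => l * x ^ 2)
    fun _ => hmeas
  have hm' : ∀ s, Measurable fun ω => l * X s ω ^ 2 := fun s => hmeas.comp (hX s)
  have hint : ∀ s, Integrable (fun ω => Real.exp (1 * (l * X s ω ^ 2))) P := by
    intro s
    have h := integrable_exp_mul_sq_gaussianReal hv hl
    rw [← hlaw s, integrable_map_measure (by fun_prop) (hX s).aemeasurable] at h
    simpa [Function.comp_def] using h
  have hmgf : ∀ s, mgf (fun ω => l * X s ω ^ 2) P 1 ≤ Real.exp (l * v + 4 * (l * v) ^ 2) := by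
    intro s
    refine le_of_eq_of_le ?_ (integral_exp_mul_sq_gaussianReal_le hv hl)
    rw [← hlaw s, integral_map (hX s).aemeasurable (by fun_prop)]
    simp [mgf]
  have hsum : (fun ω => l * ∑ s, X s ω ^ 2) = ∑ s, fun ω => l * X s ω ^ 2 := by
    ext ω; simp [Finset.mul_sum]
  have key := measure_ge_le_exp_mul_mgf (μ := P) c zero_le_one
    (hind'.integrable_exp_mul_sum (s := Finset.univ) hm' fun s _ => hint s)
  rw [← hsum] at key
  refine key.trans ?_
  rw [hsum, hind'.mgf_sum hm', Real.exp_add, neg_one_mul]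
  gcongr
  refine (Finset.prod_le_prod (fun s _ => mgf_nonneg) fun s _ => hmgf s).trans ?_
  simp [← Real.exp_nat_mul]

/-! ### The likelihood ratio -/

lemma measurable_chiSqDensity : Measurable chiSqDensity := measurable_gammaPDFReal _ _

lemma measurable_likelihoodRatio_scaledChiSq (ρ : ℝ) (q : ℕ) :
    Measurable fun z : Fin q → ℝ => likelihoodRatio (scaledChiSqDensity ρ) chiSqDensity z := by
  have := measurable_chiSqDensity
  unfold likelihoodRatio scaledChiSqDensity
  fun_prop

/-- The likelihood ratio of `q` observations as a function of their sum. -/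
def ratioOfSum (ρ : ℝ) (q : ℕ) (a : ℝ) : ℝ :=
  ((1 + ρ)⁻¹ * (1 + ρ) ^ (1 / 2 : ℝ)) ^ q * Real.exp (ρ / (2 * (1 + ρ)) * a)

/-- Turns comparisons of likelihood ratios into comparisons of sums of squares. -/
lemma ratioOfSum_le_iff {ρ : ℝ} (hρ : 0 < ρ) (q : ℕ) {a b : ℝ} :
    ratioOfSum ρ q a ≤ ratioOfSum ρ q b ↔ a ≤ b := by
  unfold ratioOfSum
  rw [mul_le_mul_iff_right₀ (by positivity), Real.exp_le_exp, mul_le_mul_iff_right₀ (by positivity)]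

lemma scaledChiSqDensity_eq {ρ z : ℝ} (hρ : 0 < ρ) (hz : 0 < z) :
    scaledChiSqDensity ρ z = ((1 + ρ)⁻¹ * (1 + ρ) ^ (1 / 2 : ℝ)) *
      Real.exp (ρ / (2 * (1 + ρ)) * z) * chiSqDensity z := by
  have h1 : 0 < 1 + ρ := by linarith
  have h2 : 0 ≤ z / (1 + ρ) := by positivity
  simp only [scaledChiSqDensity, chiSqDensity, gammaPDFReal, if_pos hz.le, if_pos h2]
  rw [Real.div_rpow hz.le h1.le, show (1 / 2 - 1 : ℝ) = -(1 / 2) by norm_num,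
    Real.rpow_neg h1.le, div_inv_eq_mul,
    show -(1 / 2 * (z / (1 + ρ))) = ρ / (2 * (1 + ρ)) * z + -(1 / 2 * z) by field_simp; ring,
    Real.exp_add]
  ring

lemma likelihoodRatio_eq {ρ : ℝ} (hρ : 0 < ρ) {q : ℕ} {z : Fin q → ℝ} (hz : ∀ s, 0 < z s) :
    likelihoodRatio (scaledChiSqDensity ρ) chiSqDensity z = ratioOfSum ρ q (∑ s, z s) := by
  have hpos : ∀ s, chiSqDensity (z s) ≠ 0 := fun s =>
    (gammaPDFReal_pos (by norm_num) (by norm_num) (hz s)).ne'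
  unfold likelihoodRatio ratioOfSum
  rw [div_eq_iff (Finset.prod_ne_zero_iff.2 fun s _ => hpos s),
    Finset.prod_congr rfl fun s _ => scaledChiSqDensity_eq hρ (hz s)]
  simp [Finset.prod_mul_distrib, Finset.mul_sum, Real.exp_sum]

/-- The closed form can fail only if some sample is 0, where `chiSqDensity` takes the value 0; a
nondegenerate normal law gives this probability zero. -/
lemma ae_likelihoodRatio_sq_eq {q : ℕ} {v : ℝ≥0} (hv : v ≠ 0) {X : Fin q → Ω → ℝ}
    (hX : ∀ s, Measurable (X s)) (hlaw : ∀ s, P.map (X s) = gaussianReal 0 v) {ρ : ℝ}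
    (hρ : 0 < ρ) :
    ∀ᵐ ω ∂P, likelihoodRatio (scaledChiSqDensity ρ) chiSqDensity (fun s => X s ω ^ 2) =
      ratioOfSum ρ q (∑ s, X s ω ^ 2) := by
  have h : ∀ s, ∀ᵐ ω ∂P, X s ω ≠ 0 := by
    intro s
    have := nullSingletonClass_gaussianReal (μ := 0) hv
    have h0 : P.map (X s) {0} = 0 := by rw [hlaw s]; exact measure_singleton 0
    rw [Measure.map_apply (hX s) (measurableSet_singleton _)] at h0
    exact compl_mem_ae_iff.2 h0
  filter_upwards [ae_all_iff.2 h] with ω hω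
  exact likelihoodRatio_eq hρ fun s => by have := hω s; positivity

/-! ### The median -/

/-- The distribution function tends to 0 at -∞. Without this bound the `sInf` in `median` would be
the default value 0. -/
lemma bddBelow_half_le_Iic {ν : Measure ℝ} [IsProbabilityMeasure ν] :
    BddBelow {x | 1 / 2 ≤ ν (Set.Iic x)} := by
  have h : Tendsto (fun x => ν (Set.Iic x)) atBot (nhds 0) := by
    simpa [ofReal_cdf] using ENNReal.tendsto_ofReal (tendsto_cdf_atBot ν)
  obtain ⟨a, ha⟩ := (h.eventually (gt_mem_nhds (show (0 : ENNReal) < 1 / 2 by simp))).exists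
  refine ⟨a, fun x hx => ?_⟩
  by_contra! hlt
  exact absurd ((hx.trans (measure_mono (Set.Iic_subset_Iic.2 hlt.le))).trans_lt ha) (lt_irrefl _)

lemma median_le {ν : Measure ℝ} [IsProbabilityMeasure ν] {x : ℝ} (hx : 1 / 2 ≤ ν (Set.Iic x)) :
    median ν ≤ x := csInf_le bddBelow_half_le_Iic hx

lemma measure_Ioi_median_le {ν : Measure ℝ} [IsProbabilityMeasure ν] :
    ν (Set.Ioi (median ν)) ≤ 1 / 2 := by
  have h : Tendsto (fun x => ν (Set.Iic x)) atTop (nhds 1) := by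
    simpa using tendsto_measure_Iic_atTop ν
  have hne : {x | 1 / 2 ≤ ν (Set.Iic x)}.Nonempty := by
    obtain ⟨a, ha⟩ := (h.eventually (lt_mem_nhds (show (1 / 2 : ENNReal) < 1 by
      rw [one_div]; exact ENNReal.inv_lt_one.2 (by norm_num)))).exists
    exact ⟨a, ha.le⟩
  have key : ∀ x, median ν < x → ν (Set.Ioi x) ≤ 1 / 2 := by
    intro x hx
    obtain ⟨y, hy, hyx⟩ := (csInf_lt_iff bddBelow_half_le_Iic hne).1 hx
    have : 1 / 2 ≤ ν (Set.Iic x) := le_trans hy (measure_mono (Set.Iic_subset_Iic.2 hyx.le))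
    rw [← Set.compl_Iic, prob_compl_eq_one_sub measurableSet_Iic]
    calc 1 - ν (Set.Iic x) ≤ 1 - 1 / 2 := tsub_le_tsub_left this _
      _ = 1 / 2 := by simp [ENNReal.one_sub_inv_two]
  -- The median itself is reached from the right: its open upper ray is the increasing union of the
  -- rays above w j.
  obtain ⟨w, hw, hw', hlim⟩ := exists_seq_strictAnti_tendsto (median ν)
  have hU : Set.Ioi (median ν) = ⋃ j, Set.Ioi (w j) := by
    ext x
    simp only [Set.mem_Ioi, Set.mem_iUnion]
    refine ⟨fun hx => (hlim.eventually (gt_mem_nhds hx)).exists, ?_⟩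
    rintro ⟨j, hj⟩
    exact (hw' j).trans hj
  rw [hU, Monotone.measure_iUnion fun i j hij => Set.Ioi_subset_Ioi (hw.antitone hij)]
  exact iSup_le fun j => key _ (hw' j)

instance : IsProbabilityMeasure chiSq :=
  Measure.isProbabilityMeasure_map (by fun_prop)

/-- Transports the median to the probability space of the actual samples, where independence and
tail bounds are available. -/
lemma threshold_eq {q : ℕ} {X : Fin q → Ω → ℝ} (hX : ∀ s, Measurable (X s))
    (hind : iIndepFun X P) (hlaw : ∀ s, P.map (X s) = gaussianReal 0 1) (ρ : ℝ) :
    threshold ρ q = median (P.map fun ω =>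
      likelihoodRatio (scaledChiSqDensity ρ) chiSqDensity fun s => X s ω ^ 2) := by
  have hsq : Measurable fun x : ℝ => x ^ 2 := by fun_prop
  have h2 := (hind.comp (fun _ x => x ^ 2) fun _ => hsq).map_fun_eq_pi_map
    (fun s => (hsq.comp (hX s)).aemeasurable)
  have h3 : ∀ s, P.map ((fun x : ℝ => x ^ 2) ∘ X s) = chiSq := fun s => by
    rw [← Measure.map_map hsq (hX s), hlaw s, chiSq]
  simp_rw [h3] at h2
  rw [threshold, ← h2, Measure.map_map (measurable_likelihoodRatio_scaledChiSq ρ q)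
    (measurable_pi_lambda _ fun s => hsq.comp (hX s))]
  rfl

/-- Under the null, a likelihood ratio exceeds the threshold with probability at most `1 / 2`. -/
lemma measure_threshold_lt_le {q : ℕ} {X : Fin q → Ω → ℝ} (hX : ∀ s, Measurable (X s))
    (hind : iIndepFun X P) (hlaw : ∀ s, P.map (X s) = gaussianReal 0 1) (ρ : ℝ) :
    P {ω | threshold ρ q <
      likelihoodRatio (scaledChiSqDensity ρ) chiSqDensity fun s => X s ω ^ 2} ≤ 1 / 2 := by
  have := hind.isProbabilityMeasure
  have hm : Measurable fun ω =>
      likelihoodRatio (scaledChiSqDensity ρ) chiSqDensity fun s => X s ω ^ 2 :=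
    (measurable_likelihoodRatio_scaledChiSq ρ q).comp (by fun_prop)
  have := Measure.isProbabilityMeasure_map (μ := P) hm.aemeasurable
  rw [threshold_eq hX hind hlaw ρ]
  refine le_of_eq_of_le ?_ (measure_Ioi_median_le (ν := P.map fun ω =>
    likelihoodRatio (scaledChiSqDensity ρ) chiSqDensity fun s => X s ω ^ 2))
  rw [Measure.map_apply hm measurableSet_Ioi]
  rfl

/-- Under the null the sum has mean q and standard deviation √(2q). It reaches q + 4√q with
probability at most e^(-3/4) ≤ 1/2, so the median of an increasing function of it is at most the
value there. -/
lemma threshold_le {ρ : ℝ} (hρ : 0 < ρ) {q : ℕ} (hq : 1 ≤ q) :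
    threshold ρ q ≤ ratioOfSum ρ q (q + 4 * √q) := by
  have hq' : (1 : ℝ) ≤ √q := Real.one_le_sqrt.2 (by exact_mod_cast hq)
  have hqq : √(q : ℝ) ^ 2 = q := Real.sq_sqrt (by positivity)
  set P : Measure (Fin q → ℝ) := Measure.pi fun _ => gaussianReal 0 1
  have hX : ∀ s : Fin q, Measurable fun x : Fin q → ℝ => x s := fun s => measurable_pi_apply s
  have hind : iIndepFun (fun (s : Fin q) (x : Fin q → ℝ) => x s) P :=
    iIndepFun_pi (X := fun _ x => x) fun _ => aemeasurable_id
  have hlaw : ∀ s : Fin q, P.map (fun x => x s) = gaussianReal 0 1 := fun s =>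
    (measurePreserving_eval (fun _ : Fin q => gaussianReal 0 1) s).map_eq
  have hm : Measurable fun x : Fin q → ℝ =>
      likelihoodRatio (scaledChiSqDensity ρ) chiSqDensity fun s => x s ^ 2 :=
    (measurable_likelihoodRatio_scaledChiSq ρ q).comp (by fun_prop)
  have := Measure.isProbabilityMeasure_map (μ := P) hm.aemeasurable
  rw [threshold_eq hX hind hlaw ρ]
  apply median_le
  rw [Measure.map_apply hm measurableSet_Iic]
  -- The tilt 1/(4√q) is admissible since q ≥ 1; the Chernoff exponent is then exactly -3/4.
  have hl : 1 / (4 * √q) * ((1 : ℝ≥0) : ℝ) ≤ 1 / 4 := by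
    rw [NNReal.coe_one, mul_one]
    exact one_div_le_one_div_of_le (by norm_num) (by linarith)
  have hch := measureReal_le_mul_sum_sq_le one_ne_zero hX hind hlaw hl
    (1 / (4 * √q) * (q + 4 * √q))
  have hexp : -(1 / (4 * √(q : ℝ)) * (q + 4 * √q)) + q * (1 / (4 * √q) * ((1 : ℝ≥0) : ℝ) +
      4 * (1 / (4 * √q) * ((1 : ℝ≥0) : ℝ)) ^ 2) = -(3 / 4) := by
    rw [NNReal.coe_one]
    nth_rewrite 2 4 [← hqq]
    field_simp
    ring_nf
  rw [hexp] at hch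
  have hhalf : Real.exp (-(3 / 4)) ≤ 1 / 2 := by
    rw [Real.exp_neg, inv_le_comm₀ (Real.exp_pos _) (by norm_num)]
    have := Real.quadratic_le_exp_of_nonneg (show (0 : ℝ) ≤ 3 / 4 by norm_num)
    norm_num at this ⊢
    linarith
  have hms : MeasurableSet {x : Fin q → ℝ |
      1 / (4 * √q) * (q + 4 * √q) ≤ 1 / (4 * √q) * ∑ s, x s ^ 2} :=
    measurableSet_le measurable_const (by fun_prop)
  have hcompl : 1 / 2 ≤ P {x | 1 / (4 * √q) * (q + 4 * √q) ≤ 1 / (4 * √q) * ∑ s, x s ^ 2}ᶜ := by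
    rw [prob_compl_eq_one_sub hms]
    have hle : P {x | 1 / (4 * √q) * (q + 4 * √q) ≤ 1 / (4 * √q) * ∑ s, x s ^ 2} ≤ 1 / 2 := by
      rw [← ENNReal.ofReal_toReal (measure_ne_top P _)]
      refine (ENNReal.ofReal_le_ofReal (hch.trans hhalf)).trans ?_
      rw [ENNReal.ofReal_div_of_pos (by norm_num)]
      simp
    calc (1 : ENNReal) / 2 = 1 - 1 / 2 := by simp [ENNReal.one_sub_inv_two]
      _ ≤ _ := tsub_le_tsub_left hle _
  refine hcompl.trans (measure_mono_ae ?_)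
  filter_upwards [ae_likelihoodRatio_sq_eq one_ne_zero hX hlaw hρ] with x hx hx'
  change likelihoodRatio _ _ _ ≤ _
  rw [hx, ratioOfSum_le_iff hρ]
  have : ¬ (1 / (4 * √(q : ℝ)) * (q + 4 * √q) ≤ 1 / (4 * √q) * ∑ s, x s ^ 2) := hx'
  rw [mul_le_mul_iff_right₀ (by positivity)] at this
  exact (not_le.1 this).le

/-- Under the alternative, a likelihood ratio rarely falls below the threshold. -/
lemma measureReal_le_threshold_le {ρ : ℝ} (hρ : 0 < ρ) (hρ1 : ρ ≤ 1) {q : ℕ}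
    (hq : 256 ≤ ρ ^ 2 * q) {X : Fin q → Ω → ℝ} (hX : ∀ s, Measurable (X s))
    (hind : iIndepFun X P) (hlaw : ∀ s, P.map (X s) = gaussianReal 0 (1 + ρ).toNNReal) :
    P.real {ω | likelihoodRatio (scaledChiSqDensity ρ) chiSqDensity (fun s => X s ω ^ 2) ≤
      threshold ρ q} ≤ Real.exp (-(ρ ^ 2 * q / 128)) := by
  have := hind.isProbabilityMeasure
  have hq1 : 1 ≤ q := by
    rcases Nat.eq_zero_or_pos q with h | h
    · simp [h] at hq; norm_num at hq
    · exact h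
  have hv : (1 + ρ).toNNReal ≠ 0 := by simp; linarith
  have hvc : (((1 + ρ).toNNReal : ℝ≥0) : ℝ) = 1 + ρ := Real.coe_toNNReal _ (by linarith)
  have hqq : √(q : ℝ) ^ 2 = q := Real.sq_sqrt (by positivity)
  have h16 : 16 ≤ ρ * √q := by
    have : (16 : ℝ) ^ 2 ≤ (ρ * √q) ^ 2 := by rw [mul_pow, hqq]; linarith
    exact le_of_sq_le_sq this (by positivity)
  -- The threshold excess 4√q is at most a quarter of the mean shift ρq.
  have h4 : 4 * √(q : ℝ) ≤ ρ * q / 4 := by nlinarith [Real.sqrt_nonneg (q : ℝ)]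
  have hl : -(ρ / 64) * (((1 + ρ).toNNReal : ℝ≥0) : ℝ) ≤ 1 / 4 := by rw [hvc]; nlinarith
  refine le_trans ?_ ((measureReal_le_mul_sum_sq_le hv hX hind hlaw hl
    (-(ρ / 64) * (q + 4 * √q))).trans (Real.exp_le_exp.2 ?_))
  · refine ENNReal.toReal_mono (measure_ne_top _ _) (measure_mono_ae ?_)
    filter_upwards [ae_likelihoodRatio_sq_eq hv hX hlaw hρ] with ω hω hω'
    change -(ρ / 64) * (q + 4 * √q) ≤ -(ρ / 64) * ∑ s, X s ω ^ 2
    have h1 : likelihoodRatio _ _ _ ≤ threshold ρ q := hω'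
    rw [hω] at h1
    have := (ratioOfSum_le_iff hρ q).1 (h1.trans (threshold_le hρ hq1))
    nlinarith
  -- The linear terms contribute -ρ²q/64; the excess 4√q and the quadratic term each give back at
  -- most ρ²q/256, leaving -ρ²q/128.
  · rw [hvc]
    have h5 : (1 + ρ) ^ 2 ≤ 4 := by nlinarith
    have h6 : 4 * (-(ρ / 64) * (1 + ρ)) ^ 2 ≤ ρ ^ 2 / 256 := by
      have : 4 * (-(ρ / 64) * (1 + ρ)) ^ 2 = ρ ^ 2 / 1024 * (1 + ρ) ^ 2 := by ring
      rw [this]; nlinarith [sq_nonneg ρ]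
    have h7 := mul_le_mul_of_nonneg_left h6 (Nat.cast_nonneg (α := ℝ) q)
    have h8 := mul_le_mul_of_nonneg_left h4 hρ.le
    nlinarith

end

end CorrDetect

/-! ### Independence and marginal laws of the samples -/

namespace CorrDetect

noncomputable section

open scoped NNReal

/-- A family of independent variables, split into blocks, gives independent blocks. -/
lemma iIndepFun_curry {Ω : Type*} [MeasurableSpace Ω] {P : Measure Ω} {ι : Type*} {κ : ι → Type*}
    {β : Type*} [MeasurableSpace β] {X : (i : ι) → κ i → Ω → β} (hX : ∀ i j, Measurable (X i j))
    (h : iIndepFun (fun (p : (i : ι) × κ i) ω => X p.1 p.2 ω) P) :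
    iIndepFun (fun i ω j => X i j ω) P := by
  have := h.isProbabilityMeasure
  have : ∀ i j, IsProbabilityMeasure (P.map (X i j)) :=
    fun i j => Measure.isProbabilityMeasure_map (hX i j).aemeasurable
  have hblock : ∀ i, P.map (fun ω j => X i j ω) = Measure.infinitePi fun j => P.map (X i j) := by
    intro i
    refine (iIndepFun_iff_map_fun_eq_infinitePi_map (hX i)).1 ?_
    exact h.precomp (g := fun j : κ i => (⟨i, j⟩ : (i : ι) × κ i)) sigma_mk_injective
  rw [iIndepFun_iff_map_fun_eq_infinitePi_map (by fun_prop)]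
  simp_rw [hblock]
  -- The joint law is a product over pairs; currying carries it to the product of the block laws.
  have hjoint := (iIndepFun_iff_map_fun_eq_infinitePi_map
    (X := fun (p : (i : ι) × κ i) ω => X p.1 p.2 ω) (fun p => hX p.1 p.2)).1 h
  rw [← Measure.infinitePi_map_piCurry (fun i j => P.map (X i j)), ← hjoint,
    Measure.map_map (by fun_prop) (by fun_prop)]
  rfl

variable {n : ℕ}

/-- Mixed-radix digits: s is the remainder modulo q, and i the remainder modulo n of the quotient.
-/
lemma slot_injective (q : ℕ) :
    Function.Injective fun x : (_ : (_ : Fin n) × ℕ) × Fin q => slot q x.1.2 x.1.1 x.2 := by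
  rintro ⟨⟨i, r⟩, s⟩ ⟨⟨i', r'⟩, s'⟩ h
  have hq : 0 < q := s.pos
  have hn : 0 < n := i.pos
  simp only [slot] at h
  have h1 : r * n + i = r' * n + i' := by
    have := congrArg (· / q) h
    simpa [Nat.mul_comm _ q, Nat.mul_add_div hq, Nat.div_eq_of_lt s.2, Nat.div_eq_of_lt s'.2]
      using this
  have h2 : (s : ℕ) = s' := by rw [h1] at h; omega
  have h3 : r = r' := by
    have := congrArg (· / n) h1
    simpa [Nat.mul_comm _ n, Nat.mul_add_div hn, Nat.div_eq_of_lt i.2, Nat.div_eq_of_lt i'.2]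
      using this
  have h4 : (i : ℕ) = i' := by rw [h3] at h1; omega
  obtain rfl := Fin.ext h2
  obtain rfl := Fin.ext h4
  subst h3
  rfl

/-- The matrix is the identity plus ρ times the rank-one matrix of the indicator of S. Positivity is
needed to read the variances off the diagonal. -/
lemma posSemidef_covUnnormalized {ρ : ℝ} (hρ : 0 < ρ) (S : Finset (Fin n)) :
    (covUnnormalized ρ S).PosSemidef := by
  have h : covUnnormalized ρ S = 1 + ρ • Matrix.vecMulVec
      (fun i => if i ∈ S then (1 : ℝ) else 0) (star fun i => if i ∈ S then (1 : ℝ) else 0) := by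
    ext i j
    by_cases hij : i = j
    · subst hij
      by_cases hi : i ∈ S <;> simp [covUnnormalized, Matrix.vecMulVec_apply, hi]
    · by_cases hi : i ∈ S <;> by_cases hj : j ∈ S <;>
        simp [covUnnormalized, Matrix.vecMulVec_apply, hi, hj, hij]
  rw [h]
  exact Matrix.PosSemidef.one.add ((Matrix.posSemidef_vecMulVec_self_star _).smul hρ.le)

instance (ρ : ℝ) (S : Finset (Fin n)) : IsProbabilityMeasure (dataLaw ρ S) := by
  unfold dataLaw; infer_instance

lemma map_sample_dataLaw {ρ : ℝ} (hρ : 0 < ρ) (S : Finset (Fin n)) (t : ℕ) (i : Fin n) :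
    (dataLaw ρ S).map (fun u => u t i) = gaussianReal 0 (if i ∈ S then 1 + ρ else 1).toNNReal := by
  have h := measurePreserving_eval_multivariateGaussian (μ := 0)
    (posSemidef_covUnnormalized hρ S) (i := i)
  have h2 := measurePreserving_eval_infinitePi
    (fun _ : ℕ => multivariateGaussian 0 (covUnnormalized ρ S)) t
  have := (h.comp h2).map_eq
  rw [show covUnnormalized ρ S i i = if i ∈ S then 1 + ρ else 1 by simp [covUnnormalized]] at this
  exact this

/-- Rows are independent and each sample comes from its own row, so correlation within S plays no
role. -/
lemma iIndepFun_samples (ρ : ℝ) (q : ℕ) (S : Finset (Fin n)) :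
    iIndepFun (fun (x : (_ : (_ : Fin n) × ℕ) × Fin q) (u : Data n) =>
      u (slot q x.1.2 x.1.1 x.2) x.1.1) (dataLaw ρ S) := by
  have h : iIndepFun (fun (t : ℕ) (u : Data n) => u t) (dataLaw ρ S) :=
    iIndepFun_infinitePi (X := fun _ x => x) fun _ => measurable_id
  exact (h.precomp (slot_injective q)).comp (fun x v => v x.1.1) fun x => by fun_prop

lemma iIndepFun_samples_step (ρ : ℝ) (q : ℕ) (S : Finset (Fin n)) (i : Fin n) (r : ℕ) :
    iIndepFun (fun (s : Fin q) (u : Data n) => u (slot q r i s) i) (dataLaw ρ S) :=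
  (iIndepFun_samples ρ q S).precomp
    (g := fun s : Fin q => (⟨⟨i, r⟩, s⟩ : (_ : (_ : Fin n) × ℕ) × Fin q))
    fun s s' h => by simpa using h

lemma measurable_stepLR (ρ : ℝ) (q r : ℕ) (i : Fin n) :
    Measurable fun u : Data n => stepLR ρ q u r i :=
  (measurable_likelihoodRatio_scaledChiSq ρ q).comp (by fun_prop)

lemma iIndepFun_stepLR (ρ : ℝ) (q : ℕ) (S : Finset (Fin n)) :
    iIndepFun (fun (p : (_ : Fin n) × ℕ) (u : Data n) => stepLR ρ q u p.2 p.1)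
      (dataLaw ρ S) := by
  have h := iIndepFun_curry (X := fun (p : (_ : Fin n) × ℕ) (s : Fin q) (u : Data n) =>
    u (slot q p.2 p.1 s) p.1) (by fun_prop) (iIndepFun_samples ρ q S)
  exact h.comp (fun _ z => likelihoodRatio (scaledChiSqDensity ρ) chiSqDensity fun s => z s ^ 2)
    fun _ => (measurable_likelihoodRatio_scaledChiSq ρ q).comp (by fun_prop)

lemma measure_threshold_lt_stepLR_le {ρ : ℝ} (hρ : 0 < ρ) (q r : ℕ) {S : Finset (Fin n)}
    {i : Fin n} (hi : i ∉ S) :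
    dataLaw ρ S {u | threshold ρ q < stepLR ρ q u r i} ≤ 1 / 2 :=
  measure_threshold_lt_le (fun s => by fun_prop) (iIndepFun_samples_step ρ q S i r)
    (fun s => by rw [map_sample_dataLaw hρ]; simp [hi]) ρ

lemma measureReal_stepLR_le_threshold_le {ρ : ℝ} (hρ : 0 < ρ) (hρ1 : ρ ≤ 1) {q : ℕ}
    (hq : 256 ≤ ρ ^ 2 * q) (r : ℕ) {S : Finset (Fin n)} {i : Fin n} (hi : i ∈ S) :
    (dataLaw ρ S).real {u | stepLR ρ q u r i ≤ threshold ρ q} ≤ Real.exp (-(ρ ^ 2 * q / 128)) :=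
  measureReal_le_threshold_le hρ hρ1 hq (fun s => by fun_prop) (iIndepFun_samples_step ρ q S i r)
    (fun s => by rw [map_sample_dataLaw hρ]; simp [hi])

end

end CorrDetect

namespace CorrDetect

noncomputable section

/-! ### Length of the initial run of values above a threshold -/

open Classical in
/-- The number of `j < m` such that the first `j` terms of `z` exceed `γ`. -/
def runLength (γ : ℝ) (m : ℕ) (z : ℕ → ℝ) : ℝ :=
  ∑ j ∈ Finset.range m, if ∀ r < j, γ < z r then 1 else 0

lemma measurableSet_run (γ : ℝ) (j : ℕ) : MeasurableSet {z : ℕ → ℝ | ∀ r < j, γ < z r} := by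
  simp only [Set.ofPred_forall]
  exact MeasurableSet.iInter fun r => MeasurableSet.iInter fun _ =>
    measurableSet_lt measurable_const (measurable_pi_apply r)

lemma measurable_runLength (γ : ℝ) (m : ℕ) : Measurable (runLength γ m) :=
  Finset.measurable_sum _ fun j _ => Measurable.ite (measurableSet_run γ j) measurable_const
    measurable_const

lemma runLength_nonneg (γ : ℝ) (m : ℕ) (z : ℕ → ℝ) : 0 ≤ runLength γ m z :=
  Finset.sum_nonneg fun _ _ => by split_ifs <;> norm_num

lemma runLength_le (γ : ℝ) (m : ℕ) (z : ℕ → ℝ) : runLength γ m z ≤ m :=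
  (Finset.sum_le_sum fun _ _ => by split_ifs <;> norm_num).trans
    (by simp : ∑ _j ∈ Finset.range m, (1 : ℝ) ≤ m)

open Classical in
-- When the run reaches j, the square grows by 2L + 1 with L ≤ j. The bound is linear in the
-- indicators, so run probabilities alone control the second moment.
lemma sq_runLength_le (γ : ℝ) (m : ℕ) (z : ℕ → ℝ) :
    runLength γ m z ^ 2 ≤
      ∑ j ∈ Finset.range m, (2 * j + 1 : ℝ) * if ∀ r < j, γ < z r then 1 else 0 := by
  induction m with
  | zero => simp [runLength]
  | succ m ih =>
    have h : runLength γ (m + 1) z = runLength γ m z + if ∀ r < m, γ < z r then 1 else 0 := by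
      rw [runLength, Finset.sum_range_succ, ← runLength]
    rw [h, Finset.sum_range_succ]
    have := runLength_le γ m z
    split_ifs <;> nlinarith

lemma sum_two_mul_add_one_div_two_pow_le (m : ℕ) :
    ∑ j ∈ Finset.range m, (2 * j + 1 : ℝ) * (1 / 2) ^ j ≤ 6 := by
  have h : ∀ m : ℕ, ∑ j ∈ Finset.range m, (2 * j + 1 : ℝ) * (1 / 2) ^ j =
      6 - (4 * m + 6) * (1 / 2) ^ m := by
    intro m
    induction m with
    | zero => simp
    | succ m ih => rw [Finset.sum_range_succ, ih, pow_succ]; push_cast; ring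
  rw [h]
  have : 0 ≤ (4 * m + 6 : ℝ) * (1 / 2) ^ m := by positivity
  linarith

section Run

variable {Ω : Type*} [MeasurableSpace Ω] {P : Measure Ω} {Z : ℕ → Ω → ℝ} {γ : ℝ}

lemma measure_run_le (hind : iIndepFun Z P) (hγ : ∀ r, P {ω | γ < Z r ω} ≤ 1 / 2) (j : ℕ) :
    P {ω | ∀ r < j, γ < Z r ω} ≤ (1 / 2) ^ j := by
  have h := hind.meas_biInter (S := Finset.range j) (s := fun r => {ω | γ < Z r ω})
    fun r _ => ⟨Set.Ioi γ, measurableSet_Ioi, rfl⟩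
  have hset : {ω | ∀ r < j, γ < Z r ω} = ⋂ r ∈ Finset.range j, {ω | γ < Z r ω} := by
    ext ω; simp
  rw [hset, h]
  exact (Finset.prod_le_prod' fun r _ => hγ r).trans (by simp)

open Classical in
lemma integral_run_le (hZ : ∀ r, Measurable (Z r)) (hind : iIndepFun Z P)
    (hγ : ∀ r, P {ω | γ < Z r ω} ≤ 1 / 2) (j : ℕ) :
    ∫ ω, (if ∀ r < j, γ < Z r ω then (1 : ℝ) else 0) ∂P ≤ (1 / 2) ^ j := by
  have := hind.isProbabilityMeasure
  have hm : MeasurableSet {ω | ∀ r < j, γ < Z r ω} :=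
    (measurable_pi_lambda _ hZ) (measurableSet_run γ j)
  have : (fun ω => if ∀ r < j, γ < Z r ω then (1 : ℝ) else 0) =
      Set.indicator {ω | ∀ r < j, γ < Z r ω} fun _ => 1 := by
    ext ω; simp [Set.indicator_apply]
  rw [this, integral_indicator_const _ hm, smul_eq_mul, mul_one]
  have h := ENNReal.toReal_mono (by simp) (measure_run_le hind hγ j)
  simpa [Measure.real] using h

open Classical in
lemma integrable_run (hZ : ∀ r, Measurable (Z r)) (hind : iIndepFun Z P) (j : ℕ) :
    Integrable (fun ω => if ∀ r < j, γ < Z r ω then (1 : ℝ) else 0) P := by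
  have := hind.isProbabilityMeasure
  have hm : MeasurableSet {ω | ∀ r < j, γ < Z r ω} :=
    (measurable_pi_lambda _ hZ) (measurableSet_run γ j)
  refine Integrable.of_bound (Measurable.ite hm measurable_const
    measurable_const).aestronglyMeasurable 1 (ae_of_all _ fun ω => ?_)
  split_ifs <;> simp

lemma integral_runLength_le (hZ : ∀ r, Measurable (Z r)) (hind : iIndepFun Z P)
    (hγ : ∀ r, P {ω | γ < Z r ω} ≤ 1 / 2) (m : ℕ) : ∫ ω, runLength γ m (fun r => Z r ω) ∂P ≤ 2 := by
  simp only [runLength]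
  rw [integral_finsetSum _ fun j _ => integrable_run hZ hind j]
  exact (Finset.sum_le_sum fun j _ => integral_run_le hZ hind hγ j).trans (sum_geometric_two_le m)

lemma memLp_runLength (hZ : ∀ r, Measurable (Z r)) (hind : iIndepFun Z P) (m : ℕ) : MemLp (fun ω => runLength γ m (fun r => Z r ω)) 2 P := by
  have := hind.isProbabilityMeasure
  refine MemLp.of_bound ((measurable_runLength γ m).comp
    (measurable_pi_lambda _ hZ)).aestronglyMeasurable m (ae_of_all _ fun ω => ?_)
  rw [Real.norm_of_nonneg (runLength_nonneg _ _ _)]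
  exact runLength_le _ _ _

/-- The second moment is at most ∑ (2j+1) 2^(-j) ≤ 6, uniformly in m; hence the total over N
coordinates has variance O(N). -/
lemma variance_runLength_le (hZ : ∀ r, Measurable (Z r)) (hind : iIndepFun Z P)
    (hγ : ∀ r, P {ω | γ < Z r ω} ≤ 1 / 2) (m : ℕ) : Var[fun ω => runLength γ m (fun r => Z r ω); P] ≤ 6 := by
  have := hind.isProbabilityMeasure
  have hL := memLp_runLength (γ := γ) hZ hind m
  refine (variance_le_expectation_sq hL.aestronglyMeasurable).trans ?_
  refine (integral_mono hL.integrable_sq (integrable_finsetSum _ fun j _ =>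
    (integrable_run (γ := γ) hZ hind j).const_mul (2 * j + 1 : ℝ))
    fun ω => sq_runLength_le γ m _).trans ?_
  rw [integral_finsetSum _ fun j _ => (integrable_run hZ hind j).const_mul _]
  refine le_trans (Finset.sum_le_sum fun j _ => ?_) (sum_two_mul_add_one_div_two_pow_le m)
  rw [integral_const_mul]
  exact mul_le_mul_of_nonneg_left (integral_run_le hZ hind hγ j) (by positivity)

end Run

/-! ### Survivors -/

variable {n : ℕ}

/-- `survivors` ignores the budget stop, so the fate of a coordinate depends on its own ratios only.
-/
lemma mem_survivors {ρ : ℝ} {q : ℕ} {B : Finset (Fin n)} {u : Data n} {r : ℕ} {i : Fin n} :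
    i ∈ survivors ρ q B u r ↔ i ∈ B ∧ ∀ r' < r, threshold ρ q < stepLR ρ q u r' i := by
  induction r with
  | zero => simp [survivors]
  | succ r ih =>
    rw [survivors, Finset.mem_filter, ih, Nat.forall_lt_succ_right, and_assoc]

/-- Double counting: the budget spent becomes a sum over coordinates, whose terms are independent,
unlike the sizes at successive steps. -/
lemma sum_card_survivors (ρ : ℝ) (q : ℕ) (B : Finset (Fin n)) (u : Data n) (m : ℕ) :
    ((∑ j ∈ Finset.range m, (survivors ρ q B u j).card : ℕ) : ℝ) =
      ∑ i ∈ B, runLength (threshold ρ q) m fun r => stepLR ρ q u r i := by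
  classical
  simp only [runLength]
  rw [Finset.sum_comm]
  push_cast
  refine Finset.sum_congr rfl fun j _ => ?_
  have : survivors ρ q B u j = B.filter fun i => ∀ r < j, threshold ρ q < stepLR ρ q u r i := by
    ext i; simp [mem_survivors]
  rw [this, Finset.card_filter]
  push_cast
  rfl

lemma iIndepFun_stepLR_coord (ρ : ℝ) (q : ℕ) (S : Finset (Fin n)) (i : Fin n) :
    iIndepFun (fun (r : ℕ) (u : Data n) => stepLR ρ q u r i) (dataLaw ρ S) :=
  (iIndepFun_stepLR ρ q S).precomp (g := fun r : ℕ => (⟨i, r⟩ : (_ : Fin n) × ℕ))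
    fun r r' h => by simpa using h

lemma measure_survivors_nonempty_le {ρ : ℝ} (hρ : 0 < ρ) (q : ℕ) (B : Finset (Fin n)) (K : ℕ) :
    dataLaw ρ ∅ {u | (survivors ρ q B u K).Nonempty} ≤ B.card * (1 / 2) ^ K := by
  have hset : {u | (survivors ρ q B u K).Nonempty} ⊆
      ⋃ i ∈ B, {u | ∀ r < K, threshold ρ q < stepLR ρ q u r i} := by
    rintro u ⟨i, hi⟩
    rw [mem_survivors] at hi
    simp only [Set.mem_iUnion]
    exact ⟨i, hi.1, hi.2⟩
  refine (measure_mono hset).trans ((measure_biUnion_finset_le B _).trans ?_)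
  refine (Finset.sum_le_card_nsmul _ _ ((1 / 2) ^ K) fun i _ => ?_).trans_eq (nsmul_eq_mul _ _)
  exact measure_run_le (iIndepFun_stepLR_coord ρ q ∅ i)
    (fun r => measure_threshold_lt_stepLR_le hρ q r (by simp)) K

/-- Uncontaminated coordinates are unlikely to use up three quarters of the budget. -/
lemma measure_sum_runLength_gt_le {ρ : ℝ} (hρ : 0 < ρ) (q : ℕ) {S B : Finset (Fin n)}
    (hB : Disjoint B S) (m : ℕ) {N : ℕ} (hN : 0 < N) (hBN : B.card ≤ N) :
    dataLaw ρ S {u | (3 * N : ℝ) < ∑ i ∈ B, runLength (threshold ρ q) m fun r =>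
      stepLR ρ q u r i} ≤ ENNReal.ofReal (6 / N) := by
  set Y : Fin n → Data n → ℝ := fun i u =>
    runLength (threshold ρ q) m fun r => stepLR ρ q u r i with hY
  have hZ : ∀ (i : Fin n) (r : ℕ), Measurable fun u : Data n => stepLR ρ q u r i :=
    fun i r => measurable_stepLR ρ q r i
  have hγ : ∀ i ∈ B, ∀ r, dataLaw ρ S {u | threshold ρ q < stepLR ρ q u r i} ≤ 1 / 2 :=
    fun i hi r => measure_threshold_lt_stepLR_le hρ q r (Finset.disjoint_left.1 hB hi)
  have hind : iIndepFun Y (dataLaw ρ S) :=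
    (iIndepFun_curry (X := fun (i : Fin n) (r : ℕ) (u : Data n) => stepLR ρ q u r i) hZ
      (iIndepFun_stepLR ρ q S)).comp _ fun _ => measurable_runLength (threshold ρ q) m
  have hL : ∀ i, MemLp (Y i) 2 (dataLaw ρ S) := fun i =>
    memLp_runLength (hZ i) (iIndepFun_stepLR_coord ρ q S i) m
  have hN' : (0 : ℝ) < N := by exact_mod_cast hN
  have hBN' : (B.card : ℝ) ≤ N := by exact_mod_cast hBN
  have hvar : Var[∑ i ∈ B, Y i; dataLaw ρ S] ≤ 6 * N := by
    rw [IndepFun.variance_sum (fun i _ => hL i) fun i _ j _ hij => hind.indepFun hij]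
    refine (Finset.sum_le_card_nsmul _ _ 6 fun i hi => variance_runLength_le (hZ i)
      (iIndepFun_stepLR_coord ρ q S i) (hγ i hi) m).trans ?_
    rw [nsmul_eq_mul]
    linarith
  have hmean : ∫ u, (∑ i ∈ B, Y i) u ∂dataLaw ρ S ≤ 2 * N := by
    simp only [Finset.sum_apply]
    rw [integral_finsetSum _ fun i _ => (hL i).integrable one_le_two]
    refine (Finset.sum_le_card_nsmul _ _ 2 fun i hi => integral_runLength_le (hZ i)
      (iIndepFun_stepLR_coord ρ q S i) (hγ i hi) m).trans ?_
    rw [nsmul_eq_mul]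
    linarith
  -- The mean is at most 2N, so exceeding 3N is a deviation of at least N, and 6N/N² = 6/N.
  have hcheb := meas_ge_le_variance_div_sq (memLp_finsetSum' B fun i _ => hL i) hN'
  refine (measure_mono fun u hu => ?_).trans (hcheb.trans (ENNReal.ofReal_le_ofReal ?_))
  · have hu' : (3 * N : ℝ) < ∑ i ∈ B, Y i u := hu
    rw [← Finset.sum_apply] at hu'
    have : (N : ℝ) ≤ (∑ i ∈ B, Y i) u - ∫ x, (∑ i ∈ B, Y i) x ∂dataLaw ρ S := by linarith
    exact this.trans (le_abs_self _)
  · rw [div_le_div_iff₀ (by positivity) hN']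
    nlinarith

/-- The probability of missing a contaminated set `S` on the subsample `B`. -/
lemma measure_not_reject_le {ρ : ℝ} (hρ : 0 < ρ) (hρ1 : ρ ≤ 1) {q : ℕ} (hq : 256 ≤ ρ ^ 2 * q)
    (S B : Finset (Fin n)) (K : ℕ) (hB : 0 < B.card) :
    dataLaw ρ S {u | ¬ (WithinBudget ρ q B.card B u K ∧ (survivors ρ q B u K).Nonempty)} ≤
      ENNReal.ofReal ((if Disjoint B S then 1 else 0) + (K + 1) * (S ∩ B).card / B.card +
        6 / B.card + K * Real.exp (-(ρ ^ 2 * q / 128))) := by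
  have hN : (0 : ℝ) < B.card := by exact_mod_cast hB
  have hA0 : (0 : ℝ) ≤ (K + 1) * (S ∩ B).card / B.card := by positivity
  have hE0 : (0 : ℝ) ≤ K * Real.exp (-(ρ ^ 2 * q / 128)) := by positivity
  by_cases hdisj : Disjoint B S
  · refine prob_le_one.trans ?_
    rw [if_pos hdisj, ← ENNReal.ofReal_one]
    refine ENNReal.ofReal_le_ofReal ?_
    have : (0 : ℝ) ≤ 6 / B.card := by positivity
    linarith
  -- Markov's inequality in pointwise form: in this case the second term is at least 1. It is linear
  -- in |S ∩ B|, so it averages exactly over B.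
  by_cases hsmall : (B.card : ℝ) < (K + 1) * (S ∩ B).card
  · refine prob_le_one.trans ?_
    rw [if_neg hdisj, ← ENNReal.ofReal_one]
    refine ENNReal.ofReal_le_ofReal ?_
    have : (0 : ℝ) ≤ 6 / B.card := by positivity
    have : 1 ≤ (K + 1) * ((S ∩ B).card : ℝ) / B.card := (one_le_div hN).2 hsmall.le
    linarith
  -- A single contaminated survivor suffices for rejection, so one is fixed.
  obtain ⟨i₀, hi₀B, hi₀S⟩ := Finset.not_disjoint_iff.1 hdisj
  have hsub : {u | ¬ (WithinBudget ρ q B.card B u K ∧ (survivors ρ q B u K).Nonempty)} ⊆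
      {u | (3 * B.card : ℝ) < ∑ i ∈ B \ S, runLength (threshold ρ q) (K + 1) fun r =>
        stepLR ρ q u r i} ∪ ⋃ r ∈ Finset.range K, {u | stepLR ρ q u r i₀ ≤ threshold ρ q} := by
    intro u hu
    rw [Set.mem_ofPred_eq, not_and_or] at hu
    rcases hu with hu | hu
    · left
      have h1 : (4 * B.card : ℝ) <
          ((∑ j ∈ Finset.range (K + 1), (survivors ρ q B u j).card : ℕ) : ℝ) := by
        exact_mod_cast not_le.1 hu
      rw [sum_card_survivors, ← Finset.sum_inter_add_sum_sdiff B S] at h1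
      -- The budget check counts the sets of indices 0 to K, hence K + 1 per coordinate.
      -- Contaminated coordinates use at most |B|, leaving more than 3|B| for the others.
      have h2 : ∑ i ∈ B ∩ S, runLength (threshold ρ q) (K + 1) (fun r => stepLR ρ q u r i) ≤
          (K + 1) * (S ∩ B).card := by
        refine (Finset.sum_le_card_nsmul _ _ _ fun i _ => runLength_le _ _ _).trans_eq ?_
        rw [nsmul_eq_mul, Finset.inter_comm]
        push_cast
        ring
      rw [Set.mem_ofPred_eq]
      linarith [not_lt.1 hsmall]
    · right
      have h1 : i₀ ∉ survivors ρ q B u K := fun h => hu ⟨i₀, h⟩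
      rw [mem_survivors] at h1
      push Not at h1
      obtain ⟨r, hr, hle⟩ := h1 hi₀B
      simp only [Set.mem_iUnion, Finset.mem_range]
      exact ⟨r, hr, hle⟩
  refine (measure_mono hsub).trans ((measure_union_le _ _).trans ?_)
  have h1 := measure_sum_runLength_gt_le hρ q (S := S) (B := B \ S) Finset.sdiff_disjoint (K + 1)
    hB (Finset.card_le_card Finset.sdiff_subset)
  have h2 : dataLaw ρ S (⋃ r ∈ Finset.range K, {u | stepLR ρ q u r i₀ ≤ threshold ρ q}) ≤
      ENNReal.ofReal (K * Real.exp (-(ρ ^ 2 * q / 128))) := by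
    refine (measure_biUnion_finset_le _ _).trans ?_
    refine (Finset.sum_le_card_nsmul _ _ (ENNReal.ofReal (Real.exp (-(ρ ^ 2 * q / 128))))
      fun r _ => ?_).trans_eq ?_
    · rw [← ENNReal.ofReal_toReal (measure_ne_top _ _)]
      exact ENNReal.ofReal_le_ofReal (measureReal_stepLR_le_threshold_le hρ hρ1 hq r hi₀S)
    · rw [Finset.card_range, nsmul_eq_mul, ENNReal.ofReal_mul (by positivity),
        ENNReal.ofReal_natCast]
  refine (add_le_add h1 h2).trans ?_
  rw [← ENNReal.ofReal_add (by positivity) hE0, if_neg hdisj]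
  exact ENNReal.ofReal_le_ofReal (by linarith)

end

end CorrDetect

/-! ### Measurability, adaptedness and budget -/

namespace CorrDetect

noncomputable section

variable {n : ℕ}

lemma measurableSet_mem_survivors (ρ : ℝ) (q : ℕ) (B : Finset (Fin n)) (r : ℕ) (i : Fin n) :
    MeasurableSet {u : Data n | i ∈ survivors ρ q B u r} := by
  simp only [mem_survivors]
  refine (MeasurableSet.const _).inter ?_
  exact (measurable_pi_lambda _ fun r => measurable_stepLR ρ q r i)
    (measurableSet_run (threshold ρ q) r)

lemma measurableSet_withinBudget (ρ : ℝ) (q N : ℕ) (B : Finset (Fin n)) (r : ℕ) :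
    MeasurableSet {u : Data n | WithinBudget ρ q N B u r} := by
  have hcard : ∀ j, Measurable fun u : Data n => (survivors ρ q B u j).card := by
    intro j
    have : (fun u : Data n => (survivors ρ q B u j).card) =
        fun u => ∑ i, Set.indicator {u : Data n | i ∈ survivors ρ q B u j} (fun _ => 1) u := by
      ext u
      simp [Set.indicator_apply]
    rw [this]
    exact Finset.measurable_sum _ fun i _ =>
      measurable_const.indicator (measurableSet_mem_survivors ρ q B j i)
  exact measurableSet_le (Finset.measurable_sum _ fun j _ => hcard j) measurable_const

lemma mem_active {ρ : ℝ} {q N : ℕ} {B : Finset (Fin n)} {u : Data n} {r : ℕ} {i : Fin n} :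
    i ∈ active ρ q N B u r ↔ WithinBudget ρ q N B u r ∧ i ∈ survivors ρ q B u r := by
  unfold active; split_ifs with h <;> simp [h]

lemma WithinBudget.mono {ρ : ℝ} {q N : ℕ} {B : Finset (Fin n)} {u : Data n} {r r' : ℕ}
    (h : WithinBudget ρ q N B u r') (hr : r ≤ r') : WithinBudget ρ q N B u r :=
  (Finset.sum_le_sum_of_subset (Finset.range_mono (by omega))).trans h

/-- The check before a step already includes the cost of that step, so the budget is never overshot;
after termination nothing is added. -/
lemma sum_card_active_le (ρ : ℝ) (q N : ℕ) (B : Finset (Fin n)) (u : Data n) (m : ℕ) :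
    ∑ r ∈ Finset.range m, (active ρ q N B u r).card ≤ 4 * N := by
  induction m with
  | zero => simp
  | succ m ih =>
    by_cases h : WithinBudget ρ q N B u m
    · refine le_trans (Finset.sum_le_sum fun r hr => ?_) h
      exact Finset.card_le_card fun i hi => (mem_active.1 hi).2
    · rw [Finset.sum_range_succ, active, if_neg h]
      simpa using ih

/-- The first `r` steps depend only on the likelihood ratios of the active coordinates. -/
lemma withinBudget_congr {ρ : ℝ} {q N : ℕ} {B : Finset (Fin n)} {u v : Data n} {r : ℕ}
    (h : ∀ r' < r, ∀ i ∈ active ρ q N B u r', stepLR ρ q u r' i = stepLR ρ q v r' i) :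
    (WithinBudget ρ q N B u r ↔ WithinBudget ρ q N B v r) ∧
      (WithinBudget ρ q N B u r → ∀ j ≤ r, survivors ρ q B u j = survivors ρ q B v j) := by
  induction r with
  | zero =>
    refine ⟨by simp [WithinBudget, survivors], fun _ j hj => ?_⟩
    obtain rfl := Nat.le_zero.1 hj
    rfl
  | succ r ih =>
    obtain ⟨ih1, ih2⟩ := ih fun r' hr' => h r' (by omega)
    by_cases hu : WithinBudget ρ q N B u r
    · have hs : ∀ j ≤ r + 1, survivors ρ q B u j = survivors ρ q B v j := by
        intro j hj
        rcases Nat.le_succ_iff.1 hj with hj | rfl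
        · exact ih2 hu j hj
        · rw [survivors, survivors, ← ih2 hu r le_rfl]
          refine Finset.filter_congr fun i hi => ?_
          rw [h r (by omega) i (mem_active.2 ⟨hu, hi⟩)]
      refine ⟨?_, fun _ => hs⟩
      unfold WithinBudget
      rw [Finset.sum_congr rfl fun j hj => by rw [hs j (by simpa [Nat.lt_succ_iff] using hj)]]
    -- Termination is permanent: if u has stopped by step r, so has v, and both remain stopped.
    · have hu' : ¬ WithinBudget ρ q N B u (r + 1) := fun h' => hu (h'.mono (by omega))
      have hv' : ¬ WithinBudget ρ q N B v (r + 1) := fun h' => hu (ih1.2 (h'.mono (by omega)))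
      exact ⟨iff_of_false hu' hv', fun h' => absurd h' hu'⟩

lemma active_congr {ρ : ℝ} {q N : ℕ} {B : Finset (Fin n)} {u v : Data n} {r : ℕ}
    (h : ∀ r' < r, ∀ i ∈ active ρ q N B u r', stepLR ρ q u r' i = stepLR ρ q v r' i) :
    active ρ q N B u r = active ρ q N B v r := by
  obtain ⟨h1, h2⟩ := withinBudget_congr h
  ext i
  rw [mem_active, mem_active, h1]
  refine and_congr_right fun hv => ?_
  rw [h2 (h1.2 hv) r le_rfl]

/-- All rounds of an earlier step precede all rounds of a later one, so a step may use every ratio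
of the steps before it. -/
lemma slot_lt_slot {q r r' : ℕ} (hr : r' < r) (i i' : Fin n) {s s' : ℕ} (hs' : s' < q) :
    slot q r' i' s' < slot q r i s := by
  unfold slot
  have h1 : r' * n + i' + 1 ≤ r * n + i := by
    have := Nat.mul_le_mul_right n (Nat.succ_le_of_lt hr)
    rw [Nat.succ_mul] at this
    have := i'.2
    omega
  have h2 := Nat.mul_le_mul_right q h1
  rw [Nat.succ_mul] at h2
  omega

theorem varianceThresholding_isAdaptive (n k M : ℕ) (ρ ε : ℝ) :
    (varianceThresholding n k M ρ ε).IsAdaptive M := by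
  set N := subsampleSize n k with hN
  set q := M / (4 * N) with hq
  set K := numSteps ε N with hK
  have hquery : ∀ (B : Finset (Fin n)) (u : Data n) (t : ℕ) (i : Fin n),
      i ∈ (varianceThresholding n k M ρ ε).query B u t ↔
        ∃ r < K, ∃ s < q, t = slot q r i s ∧ i ∈ active ρ q N B u r := by
    intro B u t i
    simp [varianceThresholding, hN, hq, hK]
  refine ⟨?_, ?_, ?_, ?_, ?_⟩
  · intro (B : Finset (Fin n)) t i
    simp only [hquery, mem_active]
    have : {u : Data n | ∃ r < K, ∃ s < q, t = slot q r i s ∧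
        WithinBudget ρ q N B u r ∧ i ∈ survivors ρ q B u r} =
        ⋃ r, ⋃ (_ : r < K), ⋃ s, ⋃ (_ : s < q), {u | t = slot q r i s ∧
          WithinBudget ρ q N B u r ∧ i ∈ survivors ρ q B u r} := by
      ext u; simp only [Set.mem_iUnion, Set.mem_ofPred_eq, exists_prop]
    rw [this]
    refine MeasurableSet.iUnion fun r => MeasurableSet.iUnion fun _ => MeasurableSet.iUnion fun s =>
      MeasurableSet.iUnion fun _ => (MeasurableSet.const _).inter ?_
    exact (measurableSet_withinBudget ρ q N B r).inter (measurableSet_mem_survivors ρ q B r i)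
  · intro (B : Finset (Fin n)) t u v h
    have hact : ∀ r < K, ∀ i : Fin n, ∀ s < q, t = slot q r i s →
        active ρ q N B u r = active ρ q N B v r := by
      rintro r hr i s hs rfl
      refine active_congr fun r' hr' j hj => ?_
      unfold stepLR
      congr 1
      ext s'
      rw [h _ (slot_lt_slot hr' i j s'.2) j
        ((hquery _ _ _ _).2 ⟨r', hr'.trans hr, s', s'.2, rfl, hj⟩)]
    ext i
    rw [hquery, hquery]
    refine exists_congr fun r => and_congr_right fun hr => exists_congr fun s =>
      and_congr_right fun hs => and_congr_right fun ht => ?_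
    rw [hact r hr i s hs ht]
  · intro (B : Finset (Fin n))
    have : {u : Data n | (varianceThresholding n k M ρ ε).reject B u} =
        {u | WithinBudget ρ q N B u K} ∩ ⋃ i, {u | i ∈ survivors ρ q B u K} := by
      ext u
      simp [varianceThresholding, hN, hq, hK, Finset.Nonempty]
    rw [this]
    exact (measurableSet_withinBudget ρ q N B K).inter
      (MeasurableSet.iUnion fun i => measurableSet_mem_survivors ρ q B K i)
  · intro (B : Finset (Fin n)) u v h
    obtain ⟨h1, h2⟩ := withinBudget_congr (ρ := ρ) (q := q) (N := N) (B := B) (u := u) (v := v)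
      (r := K) fun r hr j hj => by
        unfold stepLR
        congr 1
        ext s
        rw [h _ j ((hquery _ _ _ _).2 ⟨r, hr, s, s.2, rfl, hj⟩)]
    change WithinBudget ρ q N B u K ∧ (survivors ρ q B u K).Nonempty ↔
      WithinBudget ρ q N B v K ∧ (survivors ρ q B v K).Nonempty
    rw [h1]
    refine and_congr_right fun hv => ?_
    rw [h2 (h1.2 hv) K le_rfl]
  · intro (B : Finset (Fin n)) _ u t
    rw [← Finset.card_sigma]
    -- The sensed entries are an image of the triples (step, active coordinate, sample index), of
    -- which there are at most 4N · ⌊M/(4N)⌋ ≤ M.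
    set Q : Finset ((_ : (_ : ℕ) × Fin n) × ℕ) :=
      ((Finset.range K).sigma fun r => active ρ q N B u r).sigma fun _ => Finset.range q
    have hQ : Q.card ≤ M := by
      rw [Finset.card_sigma]
      simp only [Finset.card_range, Finset.sum_const, smul_eq_mul, Finset.card_sigma]
      calc _ ≤ 4 * N * q := Nat.mul_le_mul_right _ (sum_card_active_le ρ q N B u K)
        _ ≤ M := Nat.mul_div_le M (4 * N)
    refine le_trans ?_ hQ
    refine (Finset.card_le_card ?_).trans (Finset.card_image_le
      (s := Q) (f := fun x => (⟨slot q x.1.1 x.1.2 x.2, x.1.2⟩ : (_ : ℕ) × Fin n)))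
    rintro ⟨a, i⟩ hx
    obtain ⟨r, hr, s, hs, h : a = slot q r i s, hi⟩ := (hquery _ _ _ _).1 (Finset.mem_sigma.1 hx).2
    subst h
    refine Finset.mem_image.2 ⟨⟨⟨r, i⟩, s⟩, ?_, rfl⟩
    simp [Q, hr, hs, hi]

end

end CorrDetect

namespace CorrDetect

noncomputable section

/-! ### Averaging over the subsample -/

/-- Drawing without replacement stays inside an m-set no more often than drawing with replacement,
because (m - j)/(n - j) ≤ m/n for each factor. -/
lemma choose_mul_pow_le_choose_mul_pow {m n : ℕ} (hmn : m ≤ n) (N : ℕ) :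
    m.choose N * n ^ N ≤ n.choose N * m ^ N := by
  induction N with
  | zero => simp
  | succ N ih =>
    have h1 : (m - N) * n ≤ (n - N) * m := by
      rw [Nat.sub_mul, Nat.sub_mul, Nat.mul_comm m n]
      exact Nat.sub_le_sub_left (Nat.mul_le_mul_left N hmn) _
    refine Nat.le_of_mul_le_mul_right ?_ (Nat.succ_pos N)
    calc m.choose (N + 1) * n ^ (N + 1) * (N + 1)
        = m.choose (N + 1) * (N + 1) * n ^ (N + 1) := by ring
      _ = m.choose N * n ^ N * ((m - N) * n) := by rw [Nat.choose_succ_right_eq]; ring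
      _ ≤ n.choose N * m ^ N * ((n - N) * m) := Nat.mul_le_mul ih h1
      _ = n.choose (N + 1) * (N + 1) * m ^ (N + 1) := by rw [Nat.choose_succ_right_eq]; ring
      _ = n.choose (N + 1) * m ^ (N + 1) * (N + 1) := by ring

variable {n : ℕ}

lemma card_kSets (N : ℕ) : (kSets n N).card = n.choose N := by simp [kSets]

lemma card_filter_disjoint_kSets (S : Finset (Fin n)) (N : ℕ) :
    ((kSets n N).filter fun B => Disjoint B S).card = (n - S.card).choose N := by
  have : ((kSets n N).filter fun B => Disjoint B S) = Finset.powersetCard N Sᶜ := by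
    ext B
    simp [kSets, Finset.mem_powersetCard, Finset.subset_compl_iff_disjoint_right, and_comm]
  rw [this, Finset.card_powersetCard, Finset.card_compl, Fintype.card_fin]

lemma card_filter_mem_kSets (a : Fin n) {N : ℕ} (hN : 0 < N) :
    ((kSets n N).filter fun B => a ∈ B).card * n = n.choose N * N := by
  obtain ⟨N, rfl⟩ := Nat.exists_eq_succ_of_ne_zero hN.ne'
  obtain ⟨n, rfl⟩ := Nat.exists_eq_succ_of_ne_zero (NeZero.of_pos a.pos).out
  have h1 := Finset.card_filter_add_card_filter_not (s := kSets (n + 1) (N + 1)) (fun B => a ∈ B)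
  have h2 := card_filter_disjoint_kSets {a} (N + 1)
  simp only [Nat.succ_eq_add_one] at *
  simp only [Finset.disjoint_singleton_right, Finset.card_singleton, Nat.add_sub_cancel] at h2
  rw [h2, card_kSets, Nat.choose_succ_succ, Nat.add_right_cancel_iff] at h1
  rw [h1, Nat.mul_comm, Nat.add_one_mul_choose_eq]

/-- Linearity of expectation: each element of S lies in the subsample with probability N/n.
Denominators are cleared. -/
lemma sum_card_inter_kSets (S : Finset (Fin n)) {N : ℕ} (hN : 0 < N) :
    (∑ B ∈ kSets n N, (S ∩ B).card) * n = n.choose N * (S.card * N) := by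
  have h : ∑ B ∈ kSets n N, (S ∩ B).card =
      ∑ a ∈ S, ((kSets n N).filter fun B => a ∈ B).card := by
    simp_rw [← Finset.filter_mem_eq_inter, Finset.card_eq_sum_ones, Finset.sum_filter]
    exact Finset.sum_comm
  rw [h, Finset.sum_mul, Finset.sum_congr rfl fun a _ => card_filter_mem_kSets a hN]
  simp only [Finset.sum_const, smul_eq_mul]
  ring

lemma choose_sub_div_choose_le {k N : ℕ} (hk : k ≤ n) (hN : N ≤ n) (hn : 0 < n) :
    ((n - k).choose N : ℝ) / n.choose N ≤ Real.exp (-(k * N / n)) := by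
  have hn' : (0 : ℝ) < n := by exact_mod_cast hn
  have hc : (0 : ℝ) < n.choose N := by exact_mod_cast Nat.choose_pos hN
  have h : ((n - k).choose N : ℝ) * n ^ N ≤ n.choose N * (n - k : ℝ) ^ N := by
    have := choose_mul_pow_le_choose_mul_pow (Nat.sub_le n k) N
    rw [← Nat.cast_sub hk]
    exact_mod_cast this
  have h2 : (n - k : ℝ) / n ≤ Real.exp (-(k / n)) := by
    have := Real.add_one_le_exp (-(k / n : ℝ))
    rw [sub_div, div_self hn'.ne']
    linarith
  calc ((n - k).choose N : ℝ) / n.choose N ≤ ((n - k : ℝ) / n) ^ N := by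
        rw [div_pow, div_le_div_iff₀ hc (by positivity)]
        linarith
    _ ≤ Real.exp (-(k / n)) ^ N := by
        refine pow_le_pow_left₀ (div_nonneg ?_ hn'.le) h2 N
        have : (k : ℝ) ≤ n := by exact_mod_cast hk
        linarith
    _ = _ := by rw [← Real.exp_nat_mul]; congr 1; ring

lemma tsum_uniformOfFinset_mul_le {α : Type*} [Fintype α] {s : Finset α} (hs : s.Nonempty)
    {f : α → ENNReal} {g : α → ℝ} (hg : ∀ a ∈ s, 0 ≤ g a)
    (hfg : ∀ a ∈ s, f a ≤ ENNReal.ofReal (g a)) :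
    ∑' a, PMF.uniformOfFinset s hs a * f a ≤ ENNReal.ofReal ((∑ a ∈ s, g a) / s.card) := by
  classical
  have hc : (0 : ℝ) < s.card := by exact_mod_cast hs.card_pos
  rw [tsum_fintype, ENNReal.ofReal_div_of_pos hc, ENNReal.ofReal_natCast,
    ENNReal.ofReal_sum_of_nonneg hg, ENNReal.div_eq_inv_mul, Finset.mul_sum,
    ← Finset.sum_subset (Finset.subset_univ s)]
  · refine Finset.sum_le_sum fun a ha => ?_
    rw [PMF.uniformOfFinset_apply_of_mem hs ha]
    exact mul_le_mul_right (hfg a ha) _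
  · intro a _ ha
    rw [PMF.uniformOfFinset_apply_of_notMem hs ha, zero_mul]

lemma card_of_mem_kSets {N : ℕ} {B : Finset (Fin n)} (hB : B ∈ kSets n N) : B.card = N :=
  (Finset.mem_powersetCard.1 hB).2

/-- A nonasymptotic bound for the risk of variance thresholding. -/
theorem risk_varianceThresholding_le {k M : ℕ} {ρ ε : ℝ} (hρ : 0 < ρ) (hρ1 : ρ ≤ 1) {N q K : ℕ}
    (hN : N = subsampleSize n k) (hq : q = M / (4 * N)) (hK : K = numSteps ε N) (hN0 : 0 < N)
    (hρq : 256 ≤ ρ ^ 2 * q) :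
    (varianceThresholding n k M ρ ε).risk (dataLaw ρ) (kSets n k) ≤
      ENNReal.ofReal (N * (1 / 2) ^ K) + ENNReal.ofReal (Real.exp (-(k * N / n)) +
        (K + 1) * k / n + 6 / N + K * Real.exp (-(ρ ^ 2 * q / 128))) := by
  have hNn : N ≤ n := by rw [hN]; exact min_le_left _ _
  have hn : 0 < n := hN0.trans_le hNn
  have hn' : (0 : ℝ) < n := by exact_mod_cast hn
  have hN' : (0 : ℝ) < N := by exact_mod_cast hN0
  have hc : (0 : ℝ) < n.choose N := by exact_mod_cast Nat.choose_pos hNn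
  have hs : (kSets n N).Nonempty := hN ▸ subsamples_nonempty n k
  refine add_le_add ?_ (iSup₂_le fun S hS => ?_)
  · have h : ∀ B ∈ kSets n N, dataLaw ρ ∅ {u | WithinBudget ρ q N B u K ∧
        (survivors ρ q B u K).Nonempty} ≤ ENNReal.ofReal (N * (1 / 2) ^ K) := by
      intro B hB
      -- Under the null the budget stop can only prevent a rejection, so it is dropped.
      refine (measure_mono fun u hu => hu.2).trans
        ((measure_survivors_nonempty_le hρ q B K).trans_eq ?_)
      rw [card_of_mem_kSets hB, ENNReal.ofReal_mul (by positivity), ENNReal.ofReal_natCast,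
        ENNReal.ofReal_pow (by positivity), ENNReal.ofReal_div_of_pos (by norm_num)]
      simp
    have := tsum_uniformOfFinset_mul_le hs (fun _ _ => by positivity) h
    subst hN hq hK
    refine this.trans_eq ?_
    rw [Finset.sum_const, nsmul_eq_mul, mul_div_cancel_left₀]
    rw [card_kSets]
    exact hc.ne'
  · have hSk : S.card = k := card_of_mem_kSets hS
    have hkn : k ≤ n := by rw [← hSk]; exact card_finset_fin_le S
    have h : ∀ B ∈ kSets n N, dataLaw ρ S {u | ¬ (WithinBudget ρ q N B u K ∧
        (survivors ρ q B u K).Nonempty)} ≤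
        ENNReal.ofReal ((if Disjoint B S then 1 else 0) + (K + 1) * (S ∩ B).card / N +
          6 / N + K * Real.exp (-(ρ ^ 2 * q / 128))) := by
      intro B hB
      have hBN := card_of_mem_kSets hB
      have := measure_not_reject_le hρ hρ1 hρq S B K (hBN ▸ hN0)
      rwa [hBN] at this
    have := tsum_uniformOfFinset_mul_le hs (fun B _ => by
      have : (0 : ℝ) ≤ if Disjoint B S then 1 else 0 := by split_ifs <;> norm_num
      positivity) h
    have hmean : (∑ B ∈ kSets n N, ((S ∩ B).card : ℝ)) * n = n.choose N * (k * N) := by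
      have := sum_card_inter_kSets S hN0
      rw [hSk] at this
      exact_mod_cast this
    have hdisj : ∑ B ∈ kSets n N, (if Disjoint B S then (1 : ℝ) else 0) = (n - k).choose N := by
      rw [← hSk, ← card_filter_disjoint_kSets S N, Finset.sum_boole]
    rw [Finset.sum_add_distrib, Finset.sum_add_distrib, Finset.sum_add_distrib, hdisj,
      ← Finset.sum_div, ← Finset.mul_sum, Finset.sum_const, Finset.sum_const, nsmul_eq_mul,
      nsmul_eq_mul, card_kSets] at this
    subst hN hq hK
    refine this.trans (ENNReal.ofReal_le_ofReal ?_)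
    set N := subsampleSize n k
    rw [add_div, add_div, add_div, mul_div_cancel_left₀ _ hc.ne', mul_div_cancel_left₀ _ hc.ne']
    refine add_le_add (add_le_add (add_le_add (choose_sub_div_choose_le hkn hNn hn) ?_) le_rfl)
      le_rfl
    refine le_of_eq ?_
    rw [eq_div_iff hn'.ne', div_div, div_mul_eq_mul_div, mul_assoc, hmean]
    field_simp

end

end CorrDetect

/-! ### Asymptotics of the terms of the risk bound -/

namespace CorrDetect

noncomputable section

/-- The floor loses less than one step, which costs the factor 2. -/
lemma mul_half_pow_numSteps_le {ε : ℝ} {N : ℕ} (hN : 0 < N) :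
    (N : ℝ) * (1 / 2) ^ numSteps ε N ≤ 2 * (N : ℝ) ^ (-ε) := by
  have hN' : (0 : ℝ) < N := by exact_mod_cast hN
  have h := (Nat.sub_one_lt_floor ((1 + ε) * Real.logb 2 N)).le
  have h1 : ((1 : ℝ) / 2) ^ numSteps ε N ≤ 2 * (N : ℝ) ^ (-(1 + ε)) := by
    calc ((1 : ℝ) / 2) ^ numSteps ε N = (2 : ℝ) ^ (-(numSteps ε N : ℝ)) := by
          rw [Real.rpow_neg (by norm_num), Real.rpow_natCast, one_div, inv_pow]
      _ ≤ (2 : ℝ) ^ (1 + Real.logb 2 N * (-(1 + ε))) := by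
          refine Real.rpow_le_rpow_of_exponent_le (by norm_num) ?_
          unfold numSteps
          linarith
      _ = 2 * (N : ℝ) ^ (-(1 + ε)) := by
          rw [Real.rpow_add (by norm_num), Real.rpow_one, Real.rpow_mul (by norm_num),
            Real.rpow_logb (by norm_num) (by norm_num) hN']
  calc (N : ℝ) * (1 / 2) ^ numSteps ε N ≤ N * (2 * (N : ℝ) ^ (-(1 + ε))) := by gcongr
    _ = 2 * (N : ℝ) ^ (1 + -(1 + ε)) := by rw [Real.rpow_add hN', Real.rpow_one]; ring
    _ = _ := by ring_nf

lemma numSteps_le {ε : ℝ} (hε : 0 < ε) {N : ℕ} (hN : 0 < N) :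
    (numSteps ε N : ℝ) ≤ (1 + ε) * Real.logb 2 N :=
  Nat.floor_le (mul_nonneg (by linarith)
    (Real.logb_nonneg (by norm_num) (by exact_mod_cast hN)))

lemma tendsto_logb_two : Tendsto (fun n : ℕ => Real.logb 2 n) atTop atTop :=
  (Real.tendsto_logb_atTop (by norm_num)).comp tendsto_natCast_atTop_atTop

lemma tendsto_log_logb_two : Tendsto (fun n : ℕ => Real.log (Real.logb 2 n)) atTop atTop :=
  Real.tendsto_log_atTop.comp tendsto_logb_two

lemma tendsto_log_log : Tendsto (fun n : ℕ => Real.log (Real.log n)) atTop atTop :=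
  Real.tendsto_log_atTop.comp (Real.tendsto_log_atTop.comp tendsto_natCast_atTop_atTop)

/-- The change of base adds a constant to log log n, absorbed by squaring log log n; the outer
logarithm turns the square into a factor 2. -/
lemma eventually_log_log_logb_two_le : ∀ᶠ n : ℕ in atTop,
    Real.log (Real.log (Real.logb 2 n)) ≤ 2 * Real.log (Real.log (Real.log n)) := by
  filter_upwards [tendsto_log_log.eventually_ge_atTop (2 - Real.log (Real.log 2)),
    tendsto_log_log.eventually_ge_atTop 2, tendsto_log_logb_two.eventually_ge_atTop 1,
    (Real.tendsto_log_atTop.comp tendsto_natCast_atTop_atTop).eventually_gt_atTop 0]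
    with n h1 h2 h3 h4
  have h4' : 0 < Real.log (n : ℝ) := h4
  have h5 : Real.log (Real.logb 2 n) = Real.log (Real.log n) - Real.log (Real.log 2) := by
    rw [Real.logb, Real.log_div h4'.ne' (Real.log_pos (by norm_num)).ne']
  calc Real.log (Real.log (Real.logb 2 n)) ≤ Real.log (Real.log (Real.log n) ^ 2) :=
        Real.log_le_log (by linarith) (by rw [h5]; nlinarith)
    _ = _ := by rw [Real.log_pow]; norm_num

section Sequences

variable {k : ℕ → ℕ}

lemma tendsto_div_of_isLittleO
    (hko : Asymptotics.IsLittleO atTop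
      (fun n : ℕ => (k n : ℝ) * Real.log (Real.log (Real.log n))) (fun n : ℕ => (n : ℝ))) :
    Tendsto (fun n => (k n : ℝ) / n) atTop (nhds 0) := by
  refine squeeze_zero' (Eventually.of_forall fun n => by positivity) ?_
    hko.tendsto_div_nhds_zero
  filter_upwards [(Real.tendsto_log_atTop.comp tendsto_log_log).eventually_ge_atTop 1] with n hn
  have hn' : 1 ≤ Real.log (Real.log (Real.log (n : ℝ))) := hn
  gcongr
  exact le_mul_of_one_le_right (by positivity) hn'

lemma tendsto_div_mul_log_log_logb_two
    (hko : Asymptotics.IsLittleO atTop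
      (fun n : ℕ => (k n : ℝ) * Real.log (Real.log (Real.log n))) (fun n : ℕ => (n : ℝ))) :
    Tendsto (fun n => (k n : ℝ) / n * Real.log (Real.log (Real.logb 2 n))) atTop (nhds 0) := by
  have h := hko.tendsto_div_nhds_zero.const_mul 2
  rw [mul_zero] at h
  refine squeeze_zero' ?_ ?_ h
  · filter_upwards [tendsto_log_logb_two.eventually_ge_atTop 1] with n hn
    exact mul_nonneg (by positivity) (Real.log_nonneg hn)
  · filter_upwards [eventually_log_log_logb_two_le] with n hn
    calc _ ≤ (k n : ℝ) / n * (2 * Real.log (Real.log (Real.log n))) := by gcongr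
      _ = _ := by ring

lemma tendsto_div_mul_log_div (h : Tendsto (fun n => (k n : ℝ) / n) atTop (nhds 0)) :
    Tendsto (fun n => (k n : ℝ) / n * Real.log (n / k n)) atTop (nhds 0) := by
  have h1 : Tendsto (fun x : ℝ => x * Real.log x) (nhds 0) (nhds 0) := by
    simpa using Real.continuous_mul_log.tendsto 0
  have h2 := (h1.comp h).neg
  rw [neg_zero] at h2
  refine h2.congr fun n => ?_
  simp only [Function.comp]
  rw [← inv_div (n : ℝ) (k n), Real.log_inv]
  ring

lemma tendsto_subsampleSize (hk : Tendsto k atTop atTop)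
    (h : Tendsto (fun n => (k n : ℝ) / n) atTop (nhds 0)) :
    Tendsto (fun n => subsampleSize n (k n)) atTop atTop := by
  have h1 : Tendsto (fun n => ((k n : ℝ) / n)⁻¹) atTop atTop := by
    refine tendsto_inv_nhdsGT_zero.comp (tendsto_nhdsWithin_iff.2 ⟨h, ?_⟩)
    filter_upwards [hk.eventually_ge_atTop 1, eventually_ge_atTop 1] with n h1 h2
    have h1' : (0 : ℝ) < k n := by exact_mod_cast h1
    have h2' : (0 : ℝ) < n := by exact_mod_cast h2
    exact div_pos h1' h2'
  have h2 := ((h1.atTop_mul_atTop₀ tendsto_log_logb_two).const_mul_atTop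
    (show (0 : ℝ) < 2 by norm_num))
  have h3 : Tendsto (fun n : ℕ => ⌊2 * (n : ℝ) * Real.log (Real.logb 2 n) / k n⌋₊) atTop atTop := by
    refine tendsto_nat_floor_atTop.comp (h2.congr fun n => ?_)
    rw [inv_div]
    ring
  refine tendsto_atTop.2 fun b => ?_
  filter_upwards [h3.eventually_ge_atTop b, eventually_ge_atTop b] with n h4 h5
  exact le_min h5 h4

lemma eventually_subsampleSize_le : ∀ᶠ n : ℕ in atTop, ∀ k : ℕ,
    (subsampleSize n k : ℝ) ≤ 2 * n * Real.log (Real.logb 2 n) / k := by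
  filter_upwards [tendsto_log_logb_two.eventually_ge_atTop 0] with n hn k
  refine le_trans (Nat.cast_le.2 (min_le_right _ _)) (Nat.floor_le ?_)
  positivity

lemma tendsto_mul_subsampleSize_div (hk : Tendsto k atTop atTop)
    (h : Tendsto (fun n => (k n : ℝ) / n) atTop (nhds 0)) :
    Tendsto (fun n => (k n : ℝ) * subsampleSize n (k n) / n) atTop atTop := by
  refine tendsto_atTop.2 fun b => ?_
  filter_upwards [(tendsto_natCast_atTop_atTop (R := ℝ)).comp hk |>.eventually_ge_atTop b,
    tendsto_log_logb_two.eventually_ge_atTop (b + 1), tendsto_log_logb_two.eventually_ge_atTop 0,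
    hk.eventually_ge_atTop 1,
    h.eventually (ge_mem_nhds (show (0 : ℝ) < 1 by norm_num)), eventually_ge_atTop 1]
    with n h1 h2 h2' h3 h4 h5
  have h1' : b ≤ k n := h1
  have h3' : (0 : ℝ) < k n := by exact_mod_cast h3
  have h5' : (0 : ℝ) < n := by exact_mod_cast h5
  set p := Real.log (Real.logb 2 n) with hp
  -- If N = n the quantity is k; otherwise the floor costs at most k/n and leaves 2p - k/n.
  rcases min_choice n ⌊2 * (n : ℝ) * p / k n⌋₊ with hm | hm
  · rw [subsampleSize, ← hp, hm, mul_div_cancel_right₀ _ h5'.ne']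
    exact h1'
  · rw [subsampleSize, ← hp, hm]
    have h6 := (Nat.sub_one_lt_floor (2 * (n : ℝ) * p / k n)).le
    calc b ≤ 2 * p - k n / n := by linarith
      _ = k n * (2 * n * p / k n - 1) / n := by field_simp
      _ ≤ _ := by gcongr

/-- Here log N ≤ log 2 + log(n/k) + log p. Times k/n, the middle term vanishes because x log x → 0
at 0, and the last by k log log log n = o(n). -/
lemma tendsto_numSteps_mul_div {ε : ℝ} (hε : 0 < ε) (hk : Tendsto k atTop atTop)
    (hko : Asymptotics.IsLittleO atTop
      (fun n : ℕ => (k n : ℝ) * Real.log (Real.log (Real.log n))) (fun n : ℕ => (n : ℝ))) :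
    Tendsto (fun n => ((numSteps ε (subsampleSize n (k n)) : ℝ) + 1) * k n / n) atTop
      (nhds 0) := by
  have h := tendsto_div_of_isLittleO hko
  have hlim : Tendsto (fun n : ℕ => (k n : ℝ) / n + (1 + ε) / Real.log 2 *
      ((k n : ℝ) / n * Real.log 2 + (k n : ℝ) / n * Real.log (n / k n) +
        (k n : ℝ) / n * Real.log (Real.log (Real.logb 2 n)))) atTop (nhds 0) := by
    have := h.add ((((h.mul_const (Real.log 2)).add (tendsto_div_mul_log_div h)).add
      (tendsto_div_mul_log_log_logb_two hko)).const_mul ((1 + ε) / Real.log 2))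
    simpa using this
  refine squeeze_zero' (Eventually.of_forall fun n => by positivity) ?_ hlim
  filter_upwards [eventually_subsampleSize_le, (tendsto_subsampleSize hk h).eventually_ge_atTop 1,
    hk.eventually_ge_atTop 1, eventually_ge_atTop 1, tendsto_log_logb_two.eventually_ge_atTop 1]
    with n h1 h2 h3 h4 h5
  have h3' : (0 : ℝ) < k n := by exact_mod_cast h3
  have h4' : (0 : ℝ) < n := by exact_mod_cast h4
  have h2' : (0 : ℝ) < subsampleSize n (k n) := by exact_mod_cast h2
  have h6 : Real.log (subsampleSize n (k n)) ≤
      Real.log 2 + Real.log (n / k n) + Real.log (Real.log (Real.logb 2 n)) := by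
    rw [← Real.log_mul (by norm_num) (by positivity), ← Real.log_mul (by positivity) (by linarith)]
    refine Real.log_le_log h2' ((h1 (k n)).trans_eq ?_)
    ring
  have h7 := numSteps_le hε h2
  have hlog2 : 0 < Real.log 2 := Real.log_pos (by norm_num)
  calc ((numSteps ε (subsampleSize n (k n)) : ℝ) + 1) * k n / n
      ≤ ((1 + ε) * ((Real.log 2 + Real.log (n / k n) + Real.log (Real.log (Real.logb 2 n))) /
        Real.log 2) + 1) * k n / n := by
        gcongr
        refine h7.trans ?_
        unfold Real.logb
        gcongr
        exact h6
    _ = _ := by ring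

/-- The signal strength per step. -/
lemma eventually_log_logb_two_le_sq_mul {ρ : ℕ → ℝ} {M : ℕ → ℕ}
    (hk : Tendsto k atTop atTop) (h : Tendsto (fun n => (k n : ℝ) / n) atTop (nhds 0))
    (hm : Tendsto (fun n => (M n : ℝ) / n) atTop atTop)
    (hC : ∀ᶠ n : ℕ in atTop,
      64 * Real.log (Real.logb 2 n) ≤ ρ n * Real.sqrt (k n * ((M n : ℝ) / n))) :
    ∀ᶠ n : ℕ in atTop, 256 * Real.log (Real.logb 2 n) ≤
      ρ n ^ 2 * (M n / (4 * subsampleSize n (k n)) : ℕ) := by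
  filter_upwards [hC, eventually_subsampleSize_le, hm.eventually_ge_atTop 4,
    (tendsto_subsampleSize hk h).eventually_ge_atTop 1, hk.eventually_ge_atTop 1,
    eventually_ge_atTop 1, tendsto_log_logb_two.eventually_ge_atTop 1] with n h1 h2 h3 h4 h5 h6 h7
  have h4' : (0 : ℝ) < subsampleSize n (k n) := by exact_mod_cast h4
  have h5' : (0 : ℝ) < k n := by exact_mod_cast h5
  have h6' : (0 : ℝ) < n := by exact_mod_cast h6
  have h2 := h2 (k n)
  set p := Real.log (Real.logb 2 n) with hp
  set N := subsampleSize n (k n) with hN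
  have hNn : (N : ℝ) ≤ n := Nat.cast_le.2 (min_le_left _ _)
  set x : ℝ := (M n : ℝ) / (4 * N : ℕ) with hx
  have hx1 : 1 ≤ x := by
    rw [hx, one_le_div (by positivity)]
    rw [le_div_iff₀ h6'] at h3
    push_cast
    linarith
  -- The floor of a number x ≥ 1 is at least x/2.
  have hq : x / 2 ≤ (M n / (4 * N) : ℕ) := by
    rw [← Nat.floor_div_eq_div (K := ℝ)]
    have h8 := (Nat.sub_one_lt_floor x).le
    have h9 : (1 : ℝ) ≤ ⌊x⌋₊ := by exact_mod_cast Nat.le_floor (by exact_mod_cast hx1)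
    change x / 2 ≤ (⌊x⌋₊ : ℝ)
    linarith
  have hxl : k n * ((M n : ℝ) / n) / (8 * p) ≤ x := by
    rw [hx, div_le_div_iff₀ (by positivity) (by positivity)]
    rw [le_div_iff₀ h5'] at h2
    push_cast
    calc (k n : ℝ) * (M n / n) * (4 * N) = 4 * (M n / n) * (N * k n) := by ring
      _ ≤ 4 * (M n / n) * (2 * n * p) := by gcongr
      _ = _ := by field_simp; ring
  have hsq : (64 * p) ^ 2 ≤ ρ n ^ 2 * (k n * ((M n : ℝ) / n)) := by
    have := pow_le_pow_left₀ (by positivity) h1 2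
    rwa [mul_pow (ρ n), Real.sq_sqrt (by positivity)] at this
  have hp0 : 0 < p := by linarith
  -- The factor 16p combines 8p from N ≤ 2np/k with 2 from the floor.
  calc 256 * p = (64 * p) ^ 2 / (16 * p) := by field_simp; ring
    _ ≤ ρ n ^ 2 * (k n * ((M n : ℝ) / n)) / (16 * p) := by gcongr
    _ = ρ n ^ 2 * (k n * ((M n : ℝ) / n) / (8 * p) / 2) := by field_simp; ring
    _ ≤ ρ n ^ 2 * (x / 2) := by gcongr
    _ ≤ _ := by gcongr

/-- There are at most (1+ε) log₂ n = (1+ε)e^p steps, each failing with probability at most e^(-2p),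
as 256/128 = 2. -/
lemma tendsto_numSteps_mul_exp {ε : ℝ} (hε : 0 < ε) {a : ℕ → ℝ}
    (hN : Tendsto (fun n => subsampleSize n (k n)) atTop atTop)
    (ha : ∀ᶠ n : ℕ in atTop, 256 * Real.log (Real.logb 2 n) ≤ a n) :
    Tendsto (fun n => (numSteps ε (subsampleSize n (k n)) : ℝ) * Real.exp (-(a n / 128))) atTop
      (nhds 0) := by
  have hlim : Tendsto (fun n : ℕ => (1 + ε) * Real.exp (-Real.log (Real.logb 2 n))) atTop
      (nhds 0) := by
    simpa using (Real.tendsto_exp_neg_atTop_nhds_zero.comp tendsto_log_logb_two).const_mul (1 + ε)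
  refine squeeze_zero' (Eventually.of_forall fun n => by positivity) ?_ hlim
  filter_upwards [ha, hN.eventually_ge_atTop 1, tendsto_logb_two.eventually_gt_atTop 0]
    with n h1 h2 h3
  have h2' : (0 : ℝ) < subsampleSize n (k n) := by exact_mod_cast h2
  have h4 : (subsampleSize n (k n) : ℝ) ≤ n := Nat.cast_le.2 (min_le_left _ _)
  calc _ ≤ (1 + ε) * Real.logb 2 n * Real.exp (-(2 * Real.log (Real.logb 2 n))) := by
        gcongr
        · refine (numSteps_le hε h2).trans ?_
          gcongr
          · norm_num
        · linarith
    _ = (1 + ε) * (Real.exp (Real.log (Real.logb 2 n)) *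
        Real.exp (-(2 * Real.log (Real.logb 2 n)))) := by rw [Real.exp_log h3]; ring
    _ = _ := by rw [← Real.exp_add]; congr 2; ring

end Sequences

end

end CorrDetect

/-! ### Conclusion -/

theorem proposition6 :
    ∃ C₂ : ℝ, 0 < C₂ ∧
      ∀ (ε : ℝ), 0 < ε →
      ∀ (ρ : ℕ → ℝ) (k M : ℕ → ℕ),
        (∀ n, 0 < ρ n) →
        Tendsto ρ atTop (nhds 0) →
        Tendsto k atTop atTop →
        Tendsto (fun n => (M n : ℝ) / n) atTop atTop →
        Asymptotics.IsLittleO atTop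
          (fun n : ℕ => (k n : ℝ) * Real.log (Real.log (Real.log n))) (fun n : ℕ => (n : ℝ)) →
        (∀ᶠ n : ℕ in atTop,
          C₂ * Real.log (Real.logb 2 n) ≤ ρ n * Real.sqrt (k n * ((M n : ℝ) / n))) →
        (∀ n, (CorrDetect.varianceThresholding n (k n) (M n) (ρ n) ε).IsAdaptive (M n)) ∧
        Tendsto
          (fun n => (CorrDetect.varianceThresholding n (k n) (M n) (ρ n) ε).risk
            (CorrDetect.dataLaw (ρ n)) (CorrDetect.kSets n (k n)))
          atTop (nhds 0) := by
  -- The value 64 gives ρ²q ≥ 256p, which implies the requirement ρ²q ≥ 256 of the risk bound once p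
  -- ≥ 1.
  refine ⟨64, by norm_num, fun ε hε ρ k M hρ hρ0 hk hm hko hC =>
    ⟨fun n => CorrDetect.varianceThresholding_isAdaptive n (k n) (M n) (ρ n) ε, ?_⟩⟩
  have hkn := CorrDetect.tendsto_div_of_isLittleO hko
  have hN := CorrDetect.tendsto_subsampleSize hk hkn
  have hNreal : Tendsto (fun n => (CorrDetect.subsampleSize n (k n) : ℝ)) atTop atTop :=
    tendsto_natCast_atTop_atTop.comp hN
  have hsignal := CorrDetect.eventually_log_logb_two_le_sq_mul hk hkn hm hC
  have hnull : Tendsto (fun n => (CorrDetect.subsampleSize n (k n) : ℝ) *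
      (1 / 2) ^ CorrDetect.numSteps ε (CorrDetect.subsampleSize n (k n))) atTop (nhds 0) := by
    have hlim := ((tendsto_rpow_neg_atTop hε).comp hNreal).const_mul 2
    rw [mul_zero] at hlim
    refine squeeze_zero' (Eventually.of_forall fun n => by positivity) ?_ hlim
    filter_upwards [hN.eventually_ge_atTop 1] with n hn
    exact CorrDetect.mul_half_pow_numSteps_le hn
  -- In order: the subsample misses S, contaminated coordinates overspend, clean ones overspend, the
  -- fixed contaminated coordinate is eliminated.
  have halt := ((((Real.tendsto_exp_neg_atTop_nhds_zero.comp
    (CorrDetect.tendsto_mul_subsampleSize_div hk hkn)).add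
    (CorrDetect.tendsto_numSteps_mul_div hε hk hko)).add (hNreal.const_div_atTop 6)).add
    (CorrDetect.tendsto_numSteps_mul_exp hε hN hsignal))
  have hsum := (ENNReal.tendsto_ofReal hnull).add (ENNReal.tendsto_ofReal halt)
  simp only [add_zero, ENNReal.ofReal_zero] at hsum
  refine tendsto_of_tendsto_of_tendsto_of_le_of_le' tendsto_const_nhds hsum
    (Eventually.of_forall fun n => zero_le) ?_
  filter_upwards [hN.eventually_ge_atTop 1, hsignal,
    CorrDetect.tendsto_log_logb_two.eventually_ge_atTop 1,
    hρ0.eventually (ge_mem_nhds (show (0 : ℝ) < 1 by norm_num))] with n h1 h2 h3 h4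
  exact CorrDetect.risk_varianceThresholding_le (hρ n) h4 rfl rfl rfl h1 (by linarith)
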